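/- Let $H$ be a finite group with $M$ conjugacy classes and let $X$ be an infinite set. Let $\mathrm{Sym}(X)$ be the group of permutations of $X$ with finite support, let $H^{(X)}$ be the group of functions $X\to H$ equal to $1$ outside a finite set, and let $W=H\wr_X\mathrm{Sym}(X)=H^{(X)}\rtimes\mathrm{Sym}(X)$, with multiplication $(\varphi,f)(\psi,g)=(\varphi\cdot(\psi\circ f^{-1}),fg)$. For $u\in X$ and $a\in H\setminus\{1\}$, let $\varphi_u^a\in H^{(X)}$ be the function with value $a$ at $u$ and $1$ elsewhere. A subset $S\subseteq W$ is called partition-complete for wreath products (PCwr) if $S=S_H\sqcup S_X$, where $S_H$ consists of elements of the form $\varphi_u^a$ and $S_X$ consists of transpositions $(x\ y)$ of $X$, such that, writing $\Gamma(S_X)$ for the graph with vertex set $X$ in which $x,y$ are adjacent when $(x\ y)\in S_X$, (i) $\Gamma(S_X)$ is connected; (ii) for every $L\ge 0$ and every partition $\lambda=(\lambda_1,\dots,\lambda_k)$ of $L$, $\Gamma(S_X)$ contains (as a subgraph) a forest of $k$ pairwise disjoint trees $T_1,\dots,T_k$ such that $T_i$ has $\lambda_i$ vertices, including a vertex $x^{(i)}$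 with $\varphi_{x^{(i)}}^a\in S_H$ for all $a\in H\setminus\{1\}$. (Such a set generates $W$.) For $n\ge 0$ let $\gamma_{W,S}(n)$ be the number of conjugacy classes of $W$ for which the smallest word length of an element, with respect to $S\cup S^{-1}$, is $n$. Then for every PCwr set $S\subseteq W$, the exponential rate of conjugacy growth of $W$ with respect to $S$ is $$\limsup_{n\to\infty}\frac{\log\gamma_{W,S}(n)}{\sqrt n}=\pi\sqrt{\frac{2M}{3}}.$$ -/

import Mathlib

/-! ### Word length and conjugacy growth -/

section ConjugacyGrowth

variable {G : Type*} [Group G]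

/-- The word length of `g` with respect to `S`: the least `n` such that `g` is a product of `n`
elements of `S ∪ S⁻¹` (and `⊤` if `g` is not in the subgroup generated by `S`). -/
noncomputable def wordLength (S : Set G) (g : G) : ℕ∞ :=
  ⨅ (l : List G) (_ : (∀ s ∈ l, s ∈ S ∨ s⁻¹ ∈ S) ∧ l.prod = g), (l.length : ℕ∞)

/-- The conjugacy length: the least word length of an element of the conjugacy class `c`. -/
noncomputable def conjugacyLength (S : Set G) (c : ConjClasses G) : ℕ∞ :=
  ⨅ g ∈ c.carrier, wordLength S g

/-- The number (possibly infinite) of conjugacy classes of `G` of conjugacy length `n`. -/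
noncomputable def conjugacyGrowth (S : Set G) (n : ℕ) : ℕ∞ :=
  {c : ConjClasses G | conjugacyLength S c = n}.encard

/-- The exponential rate of conjugacy growth `limsup_n log γ(n) / √n`, as an extended real number
(with `log 0 = -∞` and `log ∞ = ∞`). -/
noncomputable def conjugacyGrowthRate (S : Set G) : EReal :=
  Filter.limsup
    (fun n : ℕ => ENNReal.log (conjugacyGrowth S n : ENNReal) / ((Real.sqrt n : ℝ) : EReal))
    Filter.atTop

end ConjugacyGrowth

/-! ### Permutational wreath products with the finitary symmetric group -/

/-- The finitary symmetric group `Sym(X)`: the permutations of `X` with finite support. -/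
def finitarySym (X : Type*) : Subgroup (Equiv.Perm X) where
  carrier := {f | {x | f x ≠ x}.Finite}
  one_mem' := by simp
  mul_mem' := by
    intro f g hf hg
    exact (hf.union hg).subset (Equiv.Perm.set_support_mul_subset f g)
  inv_mem' := by
    intro f hf
    have h : {x | f⁻¹ x ≠ x} = {x | f x ≠ x} := Equiv.Perm.set_support_symm_eq f
    exact Set.Finite.subset hf h.subset

/-- The group `H^(X)` of the functions `X → H` that are `1` outside a finite set, under pointwise
multiplication. -/
def finSuppFun (H X : Type*) [Group H] : Subgroup (X → H) where
  carrier := {φ | {x | φ x ≠ 1}.Finite}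
  one_mem' := by simp
  mul_mem' := by
    intro φ ψ hφ hψ
    refine (hφ.union hψ).subset fun x hx => ?_
    by_contra h
    simp only [Set.mem_union, Set.mem_ofPred_eq, not_or, not_not] at h
    exact hx (by simp [h.1, h.2])
  inv_mem' := by
    intro φ hφ
    simpa using hφ

/-- The action of `Sym(X)` on `H^(X)` by automorphisms: `f(ψ) = ψ ∘ f⁻¹`. -/
def finSuppFunAction (H X : Type*) [Group H] : finitarySym X →* MulAut (finSuppFun H X) where
  toFun f :=
    { toFun := fun ψ => ⟨fun x => ψ.1 ((f.1)⁻¹ x), by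
        have h : {x | ψ.1 ((f.1)⁻¹ x) ≠ 1} = f.1 '' {x | ψ.1 x ≠ 1} := by
          ext x
          simp [Equiv.image_eq_preimage_symm]
        exact ((show {x | ψ.1 x ≠ 1}.Finite from ψ.2).image _).subset h.subset⟩
      invFun := fun ψ => ⟨fun x => ψ.1 (f.1 x), by
        exact (show {x | ψ.1 x ≠ 1}.Finite from ψ.2).preimage f.1.injective.injOn⟩
      left_inv := fun ψ => by ext x; simp
      right_inv := fun ψ => by ext x; simp
      map_mul' := fun ψ χ => rfl }
  map_one' := rfl
  map_mul' f g := by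
    ext ψ x
    simp

/-- The permutational wreath product `H ≀_X Sym(X)`, i.e. the semidirect product
`H^(X) ⋊ Sym(X)` with `(φ, f) (ψ, g) = (φ f(ψ), f g)`. -/
abbrev SymWreath (H X : Type*) [Group H] : Type _ :=
  finSuppFun H X ⋊[finSuppFunAction H X] finitarySym X

section PCwr

variable {H X : Type*} [Group H]

open Classical in
/-- The element of `H^(X) ≤ H ≀_X Sym(X)` with value `a` at `u` and `1` elsewhere. -/
noncomputable def wreathSingle (u : X) (a : H) : SymWreath H X :=
  SemidirectProduct.inl ⟨Pi.mulSingle u a, by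
    refine (Set.finite_singleton u).subset fun x hx => ?_
    by_contra h
    exact hx (Pi.mulSingle_eq_of_ne (M := fun _ => H) h a)⟩

open Classical in
/-- The permutation exchanging `x` and `y`, as an element of `H ≀_X Sym(X)`. -/
noncomputable def wreathSwap (x y : X) : SymWreath H X :=
  SemidirectProduct.inr ⟨Equiv.swap x y, by
    refine (Set.toFinite {x, y}).subset fun z hz => ?_
    by_contra h
    simp only [Set.mem_insert_iff, Set.mem_singleton_iff, not_or] at h
    exact hz (Equiv.swap_apply_of_ne_of_ne h.1 h.2)⟩

theorem wreathSwap_comm (x y : X) : (wreathSwap x y : SymWreath H X) = wreathSwap y x := by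
  simp only [wreathSwap, Equiv.swap_comm]

variable (H X) in
/-- The set `T_H` of all nontrivial elements of `H^(X)` supported at a single point. -/
def wreathSingles : Set (SymWreath H X) :=
  {w | ∃ (u : X) (a : H), a ≠ 1 ∧ w = wreathSingle u a}

variable (H X) in
/-- The set `T_X` of all transpositions. -/
def wreathSwaps : Set (SymWreath H X) :=
  {w | ∃ x y : X, x ≠ y ∧ w = wreathSwap x y}

/-- The transposition graph of a set of transpositions: the vertex set is `X`, and `x`, `y` are
joined by an edge if the transposition `(x y)` is in the set. -/
def transpositionGraph (SX : Set (SymWreath H X)) : SimpleGraph X where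
  Adj x y := x ≠ y ∧ wreathSwap x y ∈ SX
  symm := ⟨fun x y h => ⟨h.1.symm, by rw [wreathSwap_comm]; exact h.2⟩⟩
  loopless := ⟨fun _ h => h.1 rfl⟩

/-- A subset of `H ≀_X Sym(X)` is partition-complete for wreath products (PCwr) if it is the union
of some `SH ⊆ T_H` and `SX ⊆ T_X` such that the transposition graph of `SX` is connected and, for
every partition `l 0 ≥ l 1 ≥ ⋯ ≥ l (k - 1) > 0`, contains a forest of `k` trees (pairwise disjoint)
whose `i`-th tree has `l i` vertices, among them one at which every nontrivial `a : H` gives an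
element of `SH`. -/
def IsPCwr (S : Set (SymWreath H X)) : Prop :=
  ∃ SH ⊆ wreathSingles H X, ∃ SX ⊆ wreathSwaps H X, S = SH ∪ SX ∧
    (transpositionGraph SX).Connected ∧
    ∀ (k : ℕ) (l : Fin k → ℕ), Antitone l → (∀ i, 0 < l i) →
      ∃ T : Fin k → (transpositionGraph SX).Subgraph,
        (∀ i j, i ≠ j → Disjoint (T i).verts (T j).verts) ∧
        ∀ i, (T i).coe.IsTree ∧ (T i).verts.ncard = l i ∧
          ∃ x ∈ (T i).verts, ∀ a : H, a ≠ 1 → wreathSingle x a ∈ SH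

end PCwr

/-! An element of `W` acts on `X × H` over a finitary permutation of `X`, and its conjugacy class is
determined by how many cycles there are with each label (conjugacy class of the cycle product,
length), trivial fixed points being ignored (`isConj_of_wreathCycleType_eq`). A cycle of length `ℓ`
costs `ℓ - 1` transpositions, plus one element `φ_u^a` when its product is nontrivial. Replacing the
length by the cost turns the labels into pairs (colour in `ConjClasses H`, positive part), so that
conjugacy classes become partitions with parts in `M` colours.

The conjugacy length is exactly the sum of the parts. A word of length `n` is a graph on `X` with
`n` edges and half-edges whose components are unions of cycles, and counting the vertices which are
not roots of half-edge-free components gives the lower bound (`cycleTypeWeight_le_wordLength`). The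
forests of a PCwr set supply a representative of exactly that cost
(`exists_hasWord_wreathCycleType_eq`). Hence `γ_{W,S}(n)` is the number `p_M(n)` of `M`-coloured
partitions of `n`.

The growth of `p_M(n)` comes from the generating function `∏ (1 - q^k)^(-M)` at `q = exp (-t)`,
whose logarithm is asymptotic to `M π² / (6t)` as `t → 0`. The upper bound is `p_M(n) qⁿ ≤ ∏` with
the best `t`. Conversely, if `p_M(n) ≤ exp (a √n)` for all large `n`, the generating function is at
most about `exp (a² / (4t))`, which forces `a² / 4 ≥ M π² / 6`. -/

/-! ### Coloured partitions -/

section ColouredPartitions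

open Finset Classical

/-- The partitions of `n` with parts coloured by `C`: `τ (c, k)` is the number of parts of size
`k + 1` and colour `c`. -/
def colouredPartitions (C : Type*) (n : ℕ) : Set (C × ℕ →₀ ℕ) :=
  {τ | τ.sum (fun i m => m * (i.2 + 1)) = n}

variable {C : Type*}

theorem mul_le_of_mem_colouredPartitions {n : ℕ} {τ : C × ℕ →₀ ℕ}
    (hτ : τ ∈ colouredPartitions C n) (i : C × ℕ) : τ i * (i.2 + 1) ≤ n := by
  by_cases h : i ∈ τ.support
  · have := single_le_sum (f := fun i => τ i * (i.2 + 1)) (fun _ _ => Nat.zero_le _) h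
    exact this.trans hτ.le
  · rw [Finsupp.notMem_support_iff] at h
    simp [h]

theorem injOn_restrict_colouredPartitions (n : ℕ) :
    Set.InjOn (fun (τ : C × ℕ →₀ ℕ) (i : C × Fin n) => τ (i.1, i.2)) (colouredPartitions C n) := by
  intro τ hτ σ hσ h
  have hz : ∀ {ρ : C × ℕ →₀ ℕ}, ρ ∈ colouredPartitions C n → ∀ (c : C) (k : ℕ), n ≤ k →
      ρ (c, k) = 0 := by
    intro ρ hρ c k hk
    have := mul_le_of_mem_colouredPartitions hρ (c, k)
    by_contra h0
    have h1 : 1 ≤ ρ (c, k) := Nat.one_le_iff_ne_zero.2 h0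
    have : 1 * (k + 1) ≤ n := (Nat.mul_le_mul_right _ h1).trans this
    omega
  ext ⟨c, k⟩
  by_cases hk : k < n
  · exact congrFun h (c, ⟨k, hk⟩)
  · rw [hz hτ c k (not_lt.1 hk), hz hσ c k (not_lt.1 hk)]

variable [Fintype C]

theorem mapsTo_restrict_colouredPartitions (n : ℕ) :
    Set.MapsTo (fun (τ : C × ℕ →₀ ℕ) (i : C × Fin n) => τ (i.1, i.2)) (colouredPartitions C n)
      ({p ∈ Fintype.piFinset (fun _ : C × Fin n => range (n + 1)) |
        ∑ i, p i * ((i.2 : ℕ) + 1) = n} : Finset (C × Fin n → ℕ)) := by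
  intro τ hτ
  simp only [coe_filter, Fintype.mem_piFinset, mem_range, Set.mem_ofPred_eq]
  refine ⟨fun i => ?_, ?_⟩
  · have := mul_le_of_mem_colouredPartitions hτ (i.1, i.2)
    have h2 : τ (i.1, i.2) * 1 ≤ τ (i.1, i.2) * ((i.2 : ℕ) + 1) := Nat.mul_le_mul_left _ (by omega)
    simp only at this
    omega
  · have h : ∑ i ∈ (univ : Finset (C × Fin n)).map
        ⟨fun i => ((i.1, (i.2 : ℕ)) : C × ℕ), fun a b h => by
          simp only [Prod.mk.injEq] at h; exact Prod.ext h.1 (Fin.ext h.2)⟩, τ i * (i.2 + 1) = n := by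
      refine Eq.trans ?_ hτ.out
      symm
      refine sum_subset (fun i hi => ?_) (fun i _ hi => by
        rw [Finsupp.notMem_support_iff] at hi; simp [hi])
      have h1 := mul_le_of_mem_colouredPartitions hτ i
      have h2 : 1 ≤ τ i := Nat.one_le_iff_ne_zero.2 (Finsupp.mem_support_iff.1 hi)
      have h3 : 1 * (i.2 + 1) ≤ n := (Nat.mul_le_mul_right _ h2).trans h1
      simp only [mem_map, mem_univ, true_and]
      exact ⟨(i.1, ⟨i.2, by omega⟩), rfl⟩
    rw [sum_map] at h
    exact h

theorem finite_colouredPartitions (n : ℕ) : (colouredPartitions C n).Finite := by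
  exact Set.Finite.of_injOn (mapsTo_restrict_colouredPartitions n)
    (injOn_restrict_colouredPartitions n) (Finset.finite_toSet _)

theorem ncard_colouredPartitions_le (n : ℕ) :
    (colouredPartitions C n).ncard ≤
      #{p ∈ Fintype.piFinset (fun _ : C × Fin n => range (n + 1)) |
        ∑ i, p i * ((i.2 : ℕ) + 1) = n} := by
  rw [← Set.ncard_coe_finset]
  exact Set.ncard_le_ncard_of_injOn _ (mapsTo_restrict_colouredPartitions n)
    (injOn_restrict_colouredPartitions n) (Finset.finite_toSet _)

theorem card_le_ncard_colouredPartitions (N m n : ℕ) :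
    #{p ∈ Fintype.piFinset (fun _ : C × Fin N => range m) |
        ∑ i, p i * ((i.2 : ℕ) + 1) = n} ≤ (colouredPartitions C n).ncard := by
  rw [← Set.ncard_coe_finset]
  let e : C × Fin N ↪ C × ℕ := ⟨fun i => (i.1, (i.2 : ℕ)), fun a b h => by
    simp only [Prod.mk.injEq] at h; exact Prod.ext h.1 (Fin.ext h.2)⟩
  refine Set.ncard_le_ncard_of_injOn
    (fun p => Finsupp.embDomain e (Finsupp.equivFunOnFinite.symm p)) ?_ ?_
    (finite_colouredPartitions n)
  · intro p hp
    simp only [coe_filter, Set.mem_ofPred_eq] at hp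
    change Finsupp.sum _ _ = n
    rw [Finsupp.sum_embDomain, Finsupp.sum_fintype _ _ (fun _ => by simp)]
    exact hp.2
  · exact ((Finsupp.embDomain_injective e).comp Finsupp.equivFunOnFinite.symm.injective).injOn

/-- Finite form of Euler's product, with parts of size at most `N` and multiplicities below `m`;
both comparisons with the generating function go through it. -/
theorem prod_geom_sum_eq (q : ℝ) (N m : ℕ) :
    (∏ k ∈ range N, ∑ j ∈ range m, (q ^ (k + 1)) ^ j) ^ Nat.card C =
      ∑ p ∈ Fintype.piFinset (fun _ : C × Fin N => range m), q ^ (∑ i, p i * ((i.2 : ℕ) + 1)) := by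
  have h := prod_univ_sum (fun _ : C × Fin N => range m)
    (fun i j => (q ^ ((i.2 : ℕ) + 1)) ^ j)
  rw [Fintype.prod_prod_type] at h
  simp only [prod_const, card_univ] at h
  rw [Fin.prod_univ_eq_prod_range (fun k => ∑ j ∈ range m, (q ^ (k + 1)) ^ j)] at h
  rw [Nat.card_eq_fintype_card, h]
  refine sum_congr rfl fun p _ => ?_
  rw [← prod_pow_eq_pow_sum]
  exact prod_congr rfl fun i _ => by rw [← pow_mul, mul_comm]

theorem ncard_colouredPartitions_mul_pow_le {q : ℝ} (h0 : 0 < q) (h1 : q < 1) (n : ℕ) :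
    (colouredPartitions C n).ncard * q ^ n ≤
      (∏ k ∈ range n, (1 - q ^ (k + 1))⁻¹) ^ Nat.card C := by
  calc ((colouredPartitions C n).ncard : ℝ) * q ^ n
      ≤ #{p ∈ Fintype.piFinset (fun _ : C × Fin n => range (n + 1)) |
        ∑ i, p i * ((i.2 : ℕ) + 1) = n} * q ^ n := by
        gcongr
        exact ncard_colouredPartitions_le n
    _ = ∑ p ∈ Fintype.piFinset (fun _ : C × Fin n => range (n + 1)) with
          ∑ i, p i * ((i.2 : ℕ) + 1) = n, q ^ (∑ i, p i * ((i.2 : ℕ) + 1)) := by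
        rw [← nsmul_eq_mul, ← sum_const]
        exact sum_congr rfl fun p hp => by rw [(mem_filter.1 hp).2]
    _ ≤ ∑ p ∈ Fintype.piFinset (fun _ : C × Fin n => range (n + 1)),
          q ^ (∑ i, p i * ((i.2 : ℕ) + 1)) :=
        sum_le_sum_of_subset_of_nonneg (filter_subset _ _) fun _ _ _ => by positivity
    _ = (∏ k ∈ range n, ∑ j ∈ range (n + 1), (q ^ (k + 1)) ^ j) ^ Nat.card C :=
        (prod_geom_sum_eq q n (n + 1)).symm
    _ ≤ _ := by
        gcongr with k _
        have hq : q ^ (k + 1) < 1 := pow_lt_one₀ h0.le h1 (by omega)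
        rw [← tsum_geometric_of_lt_one (by positivity) hq]
        exact (summable_geometric_of_lt_one (by positivity) hq).sum_le_tsum _
          fun _ _ => by positivity

-- The truncated product expands into finitely many coloured partitions, so it is dominated by a
-- partial sum of the generating function; then the multiplicity bound `m` tends to infinity.
variable (C) in
theorem prod_pow_le_of_sum_le {q B : ℝ} (h0 : 0 < q) (h1 : q < 1)
    (hB : ∀ L, ∑ n ∈ range L, (colouredPartitions C n).ncard * q ^ n ≤ B) (N : ℕ) :
    (∏ k ∈ range N, (1 - q ^ (k + 1))⁻¹) ^ Nat.card C ≤ B := by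
  have hlim : Filter.Tendsto
      (fun m => (∏ k ∈ range N, ∑ j ∈ range m, (q ^ (k + 1)) ^ j) ^ Nat.card C)
      Filter.atTop (nhds ((∏ k ∈ range N, (1 - q ^ (k + 1))⁻¹) ^ Nat.card C)) := by
    refine (tendsto_finsetProd _ fun k _ => ?_).pow _
    exact (hasSum_geometric_of_lt_one (by positivity)
      (pow_lt_one₀ h0.le h1 (by omega))).tendsto_sum_nat
  refine le_of_tendsto' hlim fun m => ?_
  rw [prod_geom_sum_eq]
  set P := Fintype.piFinset (fun _ : C × Fin N => range m)
  obtain ⟨L, hL⟩ : ∃ L, ∀ p ∈ P, ∑ i, p i * ((i.2 : ℕ) + 1) < L := by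
    obtain ⟨L, hL⟩ := (P.image fun p => ∑ i, p i * ((i.2 : ℕ) + 1)).bddAbove
    exact ⟨L + 1, fun p hp => Nat.lt_succ_of_le (hL (by simpa using ⟨p, hp, rfl⟩))⟩
  refine le_trans ?_ (hB L)
  rw [← sum_fiberwise_of_maps_to (t := range L) (fun p hp => mem_range.2 (hL p hp))]
  refine sum_le_sum fun n _ => ?_
  rw [sum_congr rfl fun p hp => by rw [(mem_filter.1 hp).2], sum_const, nsmul_eq_mul]
  gcongr
  exact card_le_ncard_colouredPartitions N m n

end ColouredPartitions

/-! ### The logarithm of the Euler product near `q = 1`. -/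

section EulerProduct

open Finset Filter Topology

theorem exp_neg_div_one_sub_le {s : ℝ} (hs : 0 < s) :
    Real.exp (-s) / (1 - Real.exp (-s)) ≤ 1 / s := by
  have h1 : Real.exp (-s) < 1 := Real.exp_lt_one_iff.2 (by linarith)
  rw [div_le_div_iff₀ (by linarith) hs]
  have h2 := Real.add_one_le_exp s
  have h3 : Real.exp (-s) * Real.exp s = 1 := by rw [← Real.exp_add]; simp
  nlinarith [Real.exp_pos (-s)]

theorem le_exp_neg_div_one_sub {s : ℝ} (hs : 0 < s) :
    1 / s - 1 ≤ Real.exp (-s) / (1 - Real.exp (-s)) := by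
  have h1 : Real.exp (-s) < 1 := Real.exp_lt_one_iff.2 (by linarith)
  have h2 := Real.add_one_le_exp (-s)
  have h3 : 1 / s - 1 = (1 - s) / s := by field_simp
  rw [h3, div_le_div_iff₀ hs (by linarith)]
  nlinarith [Real.exp_pos (-s)]

theorem hasSum_one_div_succ_sq : HasSum (fun m : ℕ => 1 / ((m : ℝ) + 1) ^ 2) (Real.pi ^ 2 / 6) := by
  have := (hasSum_nat_add_iff' 1).2 hasSum_zeta_two
  simpa using this

theorem hasSum_pow_succ {x : ℝ} (h0 : 0 ≤ x) (h1 : x < 1) :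
    HasSum (fun k : ℕ => x ^ (k + 1)) (x / (1 - x)) := by
  have := (hasSum_geometric_of_lt_one h0 h1).mul_left x
  simpa [pow_succ', div_eq_mul_inv] using this

theorem exp_neg_pow_eq (t : ℝ) (k m : ℕ) :
    (Real.exp (-t) ^ (k + 1)) ^ (m + 1) = Real.exp (-(((m : ℝ) + 1) * t)) ^ (k + 1) := by
  rw [← Real.exp_nat_mul, ← Real.exp_nat_mul, ← Real.exp_nat_mul]
  congr 1
  push_cast
  ring

/-- The logarithmic series, arranged so that for fixed `m` the sum over `k` is geometric with ratio
`exp (-(m + 1) t)`. -/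
theorem hasSum_neg_log_one_sub_exp {t : ℝ} (ht : 0 < t) (k : ℕ) :
    HasSum (fun m : ℕ => Real.exp (-(((m : ℝ) + 1) * t)) ^ (k + 1) / (m + 1))
      (-Real.log (1 - Real.exp (-t) ^ (k + 1))) := by
  have h1 : Real.exp (-t) < 1 := Real.exp_lt_one_iff.2 (by linarith)
  have h2 : |Real.exp (-t) ^ (k + 1)| < 1 := by
    rw [abs_of_pos (by positivity)]
    exact pow_lt_one₀ (by positivity) h1 (by omega)
  simpa only [exp_neg_pow_eq] using Real.hasSum_pow_div_log_of_abs_lt_one h2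

theorem one_sub_exp_neg_pow_pos {t : ℝ} (ht : 0 < t) (k : ℕ) :
    0 < 1 - Real.exp (-t) ^ (k + 1) :=
  sub_pos.2 (pow_lt_one₀ (by positivity) (Real.exp_lt_one_iff.2 (by linarith)) (by omega))

theorem log_prod_inv_one_sub_exp {t : ℝ} (ht : 0 < t) (N : ℕ) :
    Real.log (∏ k ∈ range N, (1 - Real.exp (-t) ^ (k + 1))⁻¹) =
      ∑ k ∈ range N, -Real.log (1 - Real.exp (-t) ^ (k + 1)) := by
  rw [Real.log_prod fun k _ => (inv_pos.2 (one_sub_exp_neg_pow_pos ht k)).ne']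
  simp only [Real.log_inv]

/-- After exchanging the sums, the geometric series in `k` is at most `1 / ((m + 1) t)`, leaving `∑
1 / ((m + 1)² t)`. -/
theorem log_prod_inv_one_sub_exp_le {t : ℝ} (ht : 0 < t) (N : ℕ) :
    Real.log (∏ k ∈ range N, (1 - Real.exp (-t) ^ (k + 1))⁻¹) ≤ Real.pi ^ 2 / 6 / t := by
  rw [log_prod_inv_one_sub_exp ht]
  refine hasSum_le (fun m => ?_) (hasSum_sum fun k _ => hasSum_neg_log_one_sub_exp ht k)
    (hasSum_one_div_succ_sq.div_const t)
  have hm : 0 < ((m : ℝ) + 1) * t := by positivity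
  have hx : Real.exp (-(((m : ℝ) + 1) * t)) < 1 := Real.exp_lt_one_iff.2 (by linarith)
  rw [← sum_div]
  have h1 := sum_le_hasSum (range N) (fun k _ => by positivity)
    (hasSum_pow_succ (Real.exp_pos (-(((m : ℝ) + 1) * t))).le hx)
  have h2 := h1.trans (exp_neg_div_one_sub_le hm)
  calc _ ≤ 1 / (((m : ℝ) + 1) * t) / (m + 1) := by gcongr
    _ = _ := by field_simp

/-- Same exchange of sums, keeping only the terms `m < K`. Each geometric series is within `1` of
its bound, which accounts for the error `K`; it disappears after multiplication by `t → 0`. -/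
theorem le_of_log_prod_inv_one_sub_exp_le {t B : ℝ} (ht : 0 < t)
    (hB : ∀ N, Real.log (∏ k ∈ range N, (1 - Real.exp (-t) ^ (k + 1))⁻¹) ≤ B) (K : ℕ) :
    (∑ m ∈ range K, 1 / ((m : ℝ) + 1) ^ 2) / t - K ≤ B := by
  have hpos (m : ℕ) : 0 < ((m : ℝ) + 1) * t := by positivity
  have hx (m : ℕ) : Real.exp (-(((m : ℝ) + 1) * t)) < 1 :=
    Real.exp_lt_one_iff.2 (by linarith [hpos m])
  have hlim : Tendsto (fun N => ∑ m ∈ range K,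
      (∑ k ∈ range N, Real.exp (-(((m : ℝ) + 1) * t)) ^ (k + 1)) / (m + 1)) atTop
      (𝓝 (∑ m ∈ range K, (Real.exp (-(((m : ℝ) + 1) * t)) /
        (1 - Real.exp (-(((m : ℝ) + 1) * t)))) / (m + 1))) :=
    tendsto_finsetSum _ fun m _ =>
      ((hasSum_pow_succ (Real.exp_pos _).le (hx m)).tendsto_sum_nat).div_const _
  have hle : ∑ m ∈ range K, (Real.exp (-(((m : ℝ) + 1) * t)) /
        (1 - Real.exp (-(((m : ℝ) + 1) * t)))) / (m + 1) ≤ B := by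
    refine le_of_tendsto' hlim fun N => le_trans ?_ (hB N)
    rw [log_prod_inv_one_sub_exp ht]
    simp only [sum_div]
    rw [sum_comm]
    exact sum_le_sum fun k _ =>
      sum_le_hasSum _ (fun m _ => by positivity) (hasSum_neg_log_one_sub_exp ht k)
  refine le_trans ?_ hle
  have hK : (K : ℝ) = ∑ m ∈ range K, (1 : ℝ) := by simp
  rw [hK, sum_div, ← sum_sub_distrib]
  refine sum_le_sum fun m _ => ?_
  have h1 := le_exp_neg_div_one_sub (hpos m)
  calc 1 / ((m : ℝ) + 1) ^ 2 / t - 1 ≤ 1 / ((m : ℝ) + 1) ^ 2 / t - 1 / (m + 1) := by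
        have : 1 / ((m : ℝ) + 1) ≤ 1 := by
          rw [div_le_one (by positivity)]; linarith [(Nat.cast_nonneg m : (0 : ℝ) ≤ m)]
        linarith
    _ = (1 / (((m : ℝ) + 1) * t) - 1) / (m + 1) := by field_simp
    _ ≤ _ := by gcongr

end EulerProduct

/-! ### The exponential rate of the number of coloured partitions. -/

section ColouredPartitionGrowth

open Finset Filter Topology

variable {C : Type*}

theorem ncard_colouredPartitions_pos [Finite C] [Nonempty C] (n : ℕ) :
    0 < (colouredPartitions C n).ncard := by
  have := Fintype.ofFinite C
  rw [Set.ncard_pos (finite_colouredPartitions n)]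
  obtain ⟨c⟩ := ‹Nonempty C›
  rcases n with _ | n
  · exact ⟨0, by simp [colouredPartitions]⟩
  · exact ⟨Finsupp.single (c, n) 1, by simp [colouredPartitions]⟩

theorem log_ncard_colouredPartitions_le [Finite C] [Nonempty C] {n : ℕ} (hn : 0 < n) :
    Real.log (colouredPartitions C n).ncard / √n ≤ Real.pi * √(2 * Nat.card C / 3) := by
  have := Fintype.ofFinite C
  have hM : (0 : ℝ) < Nat.card C := by exact_mod_cast Nat.card_pos
  have hn' : (0 : ℝ) < n := by exact_mod_cast hn
  set M : ℝ := (Nat.card C : ℝ) with hMdef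
  set r := √(M / 6) with hr
  have hr0 : 0 < r := Real.sqrt_pos.2 (by positivity)
  have hr2 : r ^ 2 = M / 6 := Real.sq_sqrt (by positivity)
  have hs0 : 0 < √(n : ℝ) := Real.sqrt_pos.2 hn'
  have hs2 : √(n : ℝ) ^ 2 = n := Real.sq_sqrt hn'.le
  have hc : √(2 * M / 3) = 2 * r := by
    rw [show 2 * M / 3 = (2 * r) ^ 2 by rw [mul_pow, hr2]; ring]
    exact Real.sqrt_sq (by positivity)
  rw [hc, div_le_iff₀ hs0]
  -- The minimiser of `M π² / (6t) + n t`: both terms equal `π r √n` there.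
  set t := Real.pi * r / √n with ht
  have ht0 : 0 < t := by positivity
  have hp : (0 : ℝ) < (colouredPartitions C n).ncard := by
    exact_mod_cast ncard_colouredPartitions_pos n
  have h := ncard_colouredPartitions_mul_pow_le (C := C) (Real.exp_pos (-t))
    (Real.exp_lt_one_iff.2 (by linarith)) n
  have h2 := Real.log_le_log (by positivity) h
  rw [Real.log_mul hp.ne' (by positivity), Real.log_pow, Real.log_pow, Real.log_exp] at h2
  have h3 : (Nat.card C : ℝ) * Real.log (∏ k ∈ range n, (1 - Real.exp (-t) ^ (k + 1))⁻¹) ≤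
      M * (Real.pi ^ 2 / 6 / t) := by
    gcongr
    exact log_prod_inv_one_sub_exp_le ht0 n
  have h4 : M * (Real.pi ^ 2 / 6 / t) = Real.pi * r * √n := by
    rw [show M = 6 * r ^ 2 by rw [hr2]; ring, ht]
    field_simp
  have h5 : (n : ℝ) * t = Real.pi * r * √n := by
    rw [ht]; nth_rw 1 [← hs2]; field_simp
  linarith

/-- Completing the square in `√n`. -/
theorem mul_sqrt_sub_le {a u : ℝ} (hu : 0 < u) (n : ℕ) : a * √n - n * u ≤ a ^ 2 / (4 * u) := by
  rw [le_div_iff₀ (by positivity)]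
  have hs2 : √(n : ℝ) ^ 2 = n := Real.sq_sqrt (Nat.cast_nonneg n)
  have h : (a * √(n : ℝ) - n * u) * (4 * u) = a ^ 2 - (a - 2 * u * √n) ^ 2 := by
    rw [← hs2]; simp only [Real.sqrt_sq (Real.sqrt_nonneg _)]; ring
  nlinarith [sq_nonneg (a - 2 * u * √n)]

theorem one_div_one_sub_exp_neg_le {s : ℝ} (hs : 0 < s) :
    (1 - Real.exp (-s))⁻¹ ≤ 1 + 1 / s := by
  have h1 : Real.exp (-s) < 1 := Real.exp_lt_one_iff.2 (by linarith)
  have h2 := exp_neg_div_one_sub_le hs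
  have h3 : (1 - Real.exp (-s))⁻¹ = 1 + Real.exp (-s) / (1 - Real.exp (-s)) := by
    have : 1 - Real.exp (-s) ≠ 0 := by linarith
    field_simp
    ring
  linarith

/-- If `b n ≤ exp (a √n)` for large `n`, then `∑ b n exp (-n t)` is at most about
`exp (a² / (4 t))` as `t → 0`. -/
theorem sum_mul_exp_neg_le {b : ℕ → ℝ} (hb : ∀ n, 0 ≤ b n) {a δ : ℝ} (hδ : 0 < δ) (hδ1 : δ < 1)
    {n₀ : ℕ} (h : ∀ n, n₀ ≤ n → b n ≤ Real.exp (a * √n)) {t : ℝ} (ht : 0 < t) (L : ℕ) :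
    ∑ n ∈ range L, b n * Real.exp (-t) ^ n ≤
      Real.exp (a ^ 2 / (4 * (1 - δ)) / t) * (∑ n ∈ range n₀, b n + 1 + 1 / (δ * t)) := by
  have hx1 : Real.exp (-t) ≤ 1 := (Real.exp_lt_one_iff.2 (by linarith)).le
  have hδ' : 0 < 1 - δ := by linarith
  have hE : 1 ≤ Real.exp (a ^ 2 / (4 * (1 - δ)) / t) := Real.one_le_exp (by positivity)
  have hq : Real.exp (-(δ * t)) < 1 := Real.exp_lt_one_iff.2 (by nlinarith)
  -- Split `t = (1 - δ) t + δ t`: the first share absorbs `exp (a √n)` uniformly in `n`, the second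
  -- keeps a convergent geometric series.
  have hterm : ∀ n, b n * Real.exp (-t) ^ n ≤ (if n < n₀ then b n else 0) +
      Real.exp (a ^ 2 / (4 * (1 - δ)) / t) * Real.exp (-(δ * t)) ^ n := by
    intro n
    split_ifs with hn
    · have h1 : Real.exp (-t) ^ n ≤ 1 := pow_le_one₀ (by positivity) hx1
      have h2 : b n * Real.exp (-t) ^ n ≤ b n * 1 := mul_le_mul_of_nonneg_left h1 (hb n)
      have h3 : 0 ≤ Real.exp (a ^ 2 / (4 * (1 - δ)) / t) * Real.exp (-(δ * t)) ^ n := by positivity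
      linarith
    · rw [zero_add]
      calc b n * Real.exp (-t) ^ n ≤ Real.exp (a * √n) * Real.exp (-t) ^ n := by
            gcongr; exact h n (not_lt.1 hn)
        _ = Real.exp (a * √n - n * ((1 - δ) * t)) * Real.exp (-(δ * t)) ^ n := by
            rw [← Real.exp_nat_mul, ← Real.exp_nat_mul, ← Real.exp_add, ← Real.exp_add]
            congr 1
            ring
        _ ≤ _ := by
            gcongr
            refine (mul_sqrt_sub_le (by positivity) n).trans_eq ?_
            field_simp
  calc ∑ n ∈ range L, b n * Real.exp (-t) ^ n
      ≤ ∑ n ∈ range L, ((if n < n₀ then b n else 0) +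
        Real.exp (a ^ 2 / (4 * (1 - δ)) / t) * Real.exp (-(δ * t)) ^ n) :=
        sum_le_sum fun n _ => hterm n
    _ = ∑ n ∈ range L with n < n₀, b n +
        Real.exp (a ^ 2 / (4 * (1 - δ)) / t) * ∑ n ∈ range L, Real.exp (-(δ * t)) ^ n := by
        rw [sum_add_distrib, ← mul_sum, sum_filter]
    _ ≤ ∑ n ∈ range n₀, b n + Real.exp (a ^ 2 / (4 * (1 - δ)) / t) * (1 + 1 / (δ * t)) := by
        gcongr
        · intro n _ _; exact hb n
        · intro n hn; simp at hn ⊢; exact hn.2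
        · refine le_trans ?_ (one_div_one_sub_exp_neg_le (by positivity))
          exact sum_le_hasSum _ (fun _ _ => by positivity)
            (hasSum_geometric_of_lt_one (by positivity) hq)
    _ ≤ _ := by
        have h0 : 0 ≤ ∑ n ∈ range n₀, b n := sum_nonneg fun n _ => hb n
        nlinarith

/-- At `t = 1 / j`, the prefactor of `sum_mul_exp_neg_le` is linear in `j`, so `t` times its
logarithm is negligible. -/
theorem tendsto_mul_log_add_inv {D c : ℝ} (hD : 0 ≤ D) (hc : 0 < c) :
    Tendsto (fun j : ℕ => 1 / (j : ℝ) * Real.log (D + c * j)) atTop (𝓝 0) := by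
  have h1 : Tendsto (fun j : ℕ => D + c * (j : ℝ)) atTop atTop :=
    tendsto_atTop_add_const_left _ _ (tendsto_natCast_atTop_atTop.const_mul_atTop hc)
  have h2 := (Real.isLittleO_log_id_atTop.comp_tendsto h1).tendsto_div_nhds_zero
  have h3 : Tendsto (fun j : ℕ => (D + c * (j : ℝ)) / j) atTop (𝓝 (0 + c)) := by
    have h4 : Tendsto (fun j : ℕ => D / (j : ℝ) + c) atTop (𝓝 (0 + c)) :=
      (tendsto_const_div_atTop_nhds_zero_nat D).add_const c
    refine h4.congr' ?_
    filter_upwards [eventually_gt_atTop 0] with j hj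
    have : (j : ℝ) ≠ 0 := by exact_mod_cast hj.ne'
    field_simp
  have h5 := h2.mul h3
  rw [zero_mul] at h5
  refine h5.congr' ?_
  filter_upwards [eventually_gt_atTop 0] with j hj
  have hj' : (0 : ℝ) < j := by exact_mod_cast hj
  have : D + c * j ≠ 0 := by positivity
  simp only [Function.comp, id]
  field_simp

theorem le_of_eventually_log_ncard_colouredPartitions_le [Finite C] [Nonempty C] {a : ℝ}
    (h : ∀ᶠ n : ℕ in atTop, Real.log (colouredPartitions C n).ncard / √n ≤ a) :
    Real.pi * √(2 * Nat.card C / 3) ≤ a := by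
  have := Fintype.ofFinite C
  have hM : (0 : ℝ) < Nat.card C := by exact_mod_cast Nat.card_pos
  have hp (n : ℕ) : (0 : ℝ) < (colouredPartitions C n).ncard := by
    exact_mod_cast ncard_colouredPartitions_pos n
  have ha : 0 ≤ a := by
    obtain ⟨n, hn⟩ := h.exists
    refine le_trans (div_nonneg (Real.log_nonneg ?_) (Real.sqrt_nonneg _)) hn
    exact_mod_cast ncard_colouredPartitions_pos n
  obtain ⟨n₀, hn₀⟩ := eventually_atTop.1 (h.and (eventually_gt_atTop 0))
  have hb : ∀ n, n₀ ≤ n → ((colouredPartitions C n).ncard : ℝ) ≤ Real.exp (a * √n) := by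
    intro n hn
    obtain ⟨h1, h2⟩ := hn₀ n hn
    rw [div_le_iff₀ (Real.sqrt_pos.2 (by exact_mod_cast h2))] at h1
    exact (Real.log_le_iff_le_exp (hp n)).1 h1
  -- Compare the two estimates of the generating function at `t = 1 / j`, multiply by `t` and let `j
  -- → ∞`. Afterwards `K → ∞` produces `π² / 6`, and `δ → 0` removes the loss.
  have key : ∀ δ : ℝ, 0 < δ → δ < 1 → ∀ K : ℕ,
      Nat.card C * ∑ m ∈ range K, 1 / ((m : ℝ) + 1) ^ 2 ≤ a ^ 2 / (4 * (1 - δ)) := by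
    intro δ hδ hδ1 K
    set D := ∑ n ∈ range n₀, ((colouredPartitions C n).ncard : ℝ) + 1 with hD
    have hD0 : 0 < D := by
      have : 0 ≤ ∑ n ∈ range n₀, ((colouredPartitions C n).ncard : ℝ) :=
        sum_nonneg fun n _ => (hp n).le
      linarith
    have hlim : Tendsto (fun j : ℕ => a ^ 2 / (4 * (1 - δ)) +
        1 / (j : ℝ) * Real.log (D + 1 / δ * j) + Nat.card C * K * (1 / (j : ℝ))) atTop
        (𝓝 (a ^ 2 / (4 * (1 - δ)) + 0 + Nat.card C * K * 0)) :=
      ((tendsto_mul_log_add_inv hD0.le (by positivity)).const_add _).add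
        (tendsto_one_div_atTop_nhds_zero_nat.const_mul _)
    rw [add_zero, mul_zero, add_zero] at hlim
    refine ge_of_tendsto hlim ?_
    filter_upwards [eventually_gt_atTop 0] with j hj
    have hj' : (0 : ℝ) < j := by exact_mod_cast hj
    have ht : (0 : ℝ) < 1 / j := by positivity
    have h1 := prod_pow_le_of_sum_le C (Real.exp_pos (-(1 / (j : ℝ))))
      (Real.exp_lt_one_iff.2 (by linarith))
      (fun L => sum_mul_exp_neg_le (fun n => (hp n).le) hδ hδ1 hb ht L)
    have h2 (N : ℕ) : Real.log (∏ k ∈ range N, (1 - Real.exp (-(1 / (j : ℝ))) ^ (k + 1))⁻¹) ≤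
        (a ^ 2 / (4 * (1 - δ)) * j + Real.log (D + 1 / δ * j)) / Nat.card C := by
      have hpos : 0 < ∏ k ∈ range N, (1 - Real.exp (-(1 / (j : ℝ))) ^ (k + 1))⁻¹ :=
        prod_pos fun k _ => inv_pos.2 (one_sub_exp_neg_pow_pos ht k)
      have h3 := Real.log_le_log (by positivity) (h1 N)
      rw [Real.log_pow, Real.log_mul (by positivity) (by positivity), Real.log_exp] at h3
      rw [le_div_iff₀ hM, mul_comm]
      have e1 : a ^ 2 / (4 * (1 - δ)) / (1 / (j : ℝ)) = a ^ 2 / (4 * (1 - δ)) * j := by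
        rw [div_div_eq_mul_div, div_one]
      have e2 : 1 / (δ * (1 / (j : ℝ))) = 1 / δ * j := by field_simp
      rwa [e1, e2] at h3
    have h4 := le_of_log_prod_inv_one_sub_exp_le ht h2 K
    rw [le_div_iff₀ hM, div_div_eq_mul_div, div_one] at h4
    have h5 := mul_le_mul_of_nonneg_left h4 ht.le
    have e3 : 1 / (j : ℝ) * (((∑ m ∈ range K, 1 / ((m : ℝ) + 1) ^ 2) * j - K) * Nat.card C) =
        Nat.card C * (∑ m ∈ range K, 1 / ((m : ℝ) + 1) ^ 2) - Nat.card C * K * (1 / (j : ℝ)) := by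
      field_simp
    have e4 : 1 / (j : ℝ) * (a ^ 2 / (4 * (1 - δ)) * j + Real.log (D + 1 / δ * j)) =
        a ^ 2 / (4 * (1 - δ)) + 1 / (j : ℝ) * Real.log (D + 1 / δ * j) := by
      rw [mul_add]
      congr 1
      rw [mul_comm, mul_assoc, mul_one_div_cancel hj'.ne', mul_one]
    rw [e3, e4] at h5
    linarith
  have key2 : Nat.card C * (Real.pi ^ 2 / 6) ≤ a ^ 2 / 4 := by
    have hz : ∀ δ : ℝ, 0 < δ → δ < 1 →
        Nat.card C * (Real.pi ^ 2 / 6) ≤ a ^ 2 / (4 * (1 - δ)) := fun δ h0 h1 =>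
      le_of_tendsto' (hasSum_one_div_succ_sq.tendsto_sum_nat.const_mul _) (key δ h0 h1)
    have hlim : Tendsto (fun δ : ℝ => a ^ 2 / (4 * (1 - δ))) (𝓝[>] 0)
        (𝓝 (a ^ 2 / (4 * (1 - 0)))) := by
      refine (ContinuousAt.tendsto ?_).mono_left nhdsWithin_le_nhds
      fun_prop (disch := norm_num)
    rw [sub_zero, mul_one] at hlim
    refine ge_of_tendsto hlim ?_
    filter_upwards [Ioo_mem_nhdsGT (zero_lt_one' ℝ)] with δ hδ
    exact hz δ hδ.1 hδ.2
  refine abs_le_of_sq_le_sq' ?_ ha |>.2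
  rw [mul_pow, Real.sq_sqrt (by positivity)]
  linarith

variable (C) in
theorem limsup_log_encard_colouredPartitions [Finite C] [Nonempty C] :
    limsup (fun n : ℕ => ENNReal.log ((colouredPartitions C n).encard : ENNReal) /
      ((√n : ℝ) : EReal)) atTop = ((Real.pi * √(2 * (Nat.card C : ℝ) / 3) : ℝ) : EReal) := by
  have := Fintype.ofFinite C
  -- The counts are positive and finite, so the extended logarithm is the real one.
  have hfun : (fun n : ℕ => ENNReal.log ((colouredPartitions C n).encard : ENNReal) /
      ((√n : ℝ) : EReal)) =
      fun n : ℕ => ((Real.log (colouredPartitions C n).ncard / √n : ℝ) : EReal) := by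
    ext n
    have hp := ncard_colouredPartitions_pos (C := C) n
    rw [← (finite_colouredPartitions n).cast_ncard_eq, EReal.coe_div, ENNReal.log_pos_real']
    · simp
    · simpa using hp
  rw [hfun]
  refine le_antisymm ?_ ?_
  · refine limsup_le_of_le (h := ?_)
    filter_upwards [eventually_gt_atTop 0] with n hn
    exact EReal.coe_le_coe_iff.2 (log_ncard_colouredPartitions_le hn)
  · by_contra! hlt
    obtain ⟨a, h1, h2⟩ := EReal.lt_iff_exists_real_btwn.1 hlt
    have h3 := eventually_lt_of_limsup_lt h1
    refine absurd (EReal.coe_lt_coe_iff.1 h2)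
      (not_lt.2 (le_of_eventually_log_ncard_colouredPartitions_le (C := C) ?_))
    filter_upwards [h3] with n hn
    exact (EReal.coe_lt_coe_iff.1 hn).le

end ColouredPartitionGrowth

/-! ### Permutations, fibre factors and cycle types of elements of the wreath product. -/

section WreathBasic

variable {H X : Type*} [Group H]

/-- The permutation of `X` underlying an element of `H ≀_X Sym(X)`. -/
def wreathPerm : SymWreath H X →* Equiv.Perm X :=
  (finitarySym X).subtype.comp SemidirectProduct.rightHom

/-- The factor by which `w` acts on the fibre over `x`, when `w` acts on `X × H` by
`(x, h) ↦ (f x, φ (f x) h)`. -/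
def wreathTwist (w : SymWreath H X) (x : X) : H := w.left.1 (w.right.1 x)

/-- Cocycle identity for composing the maps of `X × H`; cycle products are computed from it. -/
theorem wreathTwist_mul (w v : SymWreath H X) (x : X) :
    wreathTwist (w * v) x = wreathTwist w (wreathPerm v x) * wreathTwist v x := by
  simp [wreathTwist, wreathPerm, finSuppFunAction]
  rfl

@[simp]
theorem wreathTwist_one (x : X) : wreathTwist (1 : SymWreath H X) x = 1 := rfl

theorem wreathTwist_inv (w : SymWreath H X) (x : X) :
    wreathTwist w⁻¹ (wreathPerm w x) = (wreathTwist w x)⁻¹ := by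
  rw [eq_inv_iff_mul_eq_one, ← wreathTwist_mul, inv_mul_cancel, wreathTwist_one]

theorem wreath_ext {w v : SymWreath H X} (hp : ∀ x, wreathPerm w x = wreathPerm v x)
    (ht : ∀ x, wreathTwist w x = wreathTwist v x) : w = v := by
  have hr : w.right = v.right := Subtype.ext (Equiv.ext hp)
  refine SemidirectProduct.ext ?_ hr
  ext x
  have := ht (w.right.1⁻¹ x)
  simpa [wreathTwist, ← hr] using this

theorem finite_wreathPerm_ne (w : SymWreath H X) : {x | wreathPerm w x ≠ x}.Finite := w.right.2

theorem finite_wreathTwist_ne (w : SymWreath H X) : {x | wreathTwist w x ≠ 1}.Finite :=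
  Set.Finite.preimage (s := {x | w.left.1 x ≠ 1}) w.right.1.injective.injOn w.left.2

theorem exists_wreath_eq (σ : Equiv.Perm X) (hσ : {x | σ x ≠ x}.Finite) (θ : X → H)
    (hθ : {x | θ x ≠ 1}.Finite) :
    ∃ w : SymWreath H X, wreathPerm w = σ ∧ ∀ x, wreathTwist w x = θ x := by
  refine ⟨⟨⟨fun x => θ (σ⁻¹ x), ?_⟩, ⟨σ, hσ⟩⟩, rfl, fun x => ?_⟩
  · exact Set.Finite.preimage (s := {x | θ x ≠ 1}) (σ⁻¹).injective.injOn hθ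
  · simp [wreathTwist]

theorem wreathPerm_single (u : X) (a : H) : wreathPerm (wreathSingle u a) = 1 := rfl

open Classical in
theorem wreathTwist_single (u : X) (a : H) (x : X) :
    wreathTwist (wreathSingle u a) x = if x = u then a else 1 := by
  simp [wreathTwist, wreathSingle, Pi.mulSingle_apply]

open Classical in
theorem wreathPerm_swap (x y : X) :
    wreathPerm (wreathSwap x y : SymWreath H X) = Equiv.swap x y := rfl

theorem wreathTwist_swap (x y z : X) : wreathTwist (wreathSwap x y : SymWreath H X) z = 1 := rfl

theorem wreathTwist_pow_eq_one {w : SymWreath H X} {x : X}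
    (h : ∀ n : ℕ, wreathTwist w ((wreathPerm w ^ n) x) = 1) (n : ℕ) :
    wreathTwist (w ^ n) x = 1 := by
  induction n with
  | zero => simp
  | succ n ih => rw [pow_succ', wreathTwist_mul, ih, map_pow, h, one_mul]

/-! ### Cycles and their labels -/

theorem isPeriodicPt_perm_iff {f : Equiv.Perm X} {n : ℕ} {x : X} :
    Function.IsPeriodicPt f n x ↔ (f ^ n) x = x := by
  rw [Function.IsPeriodicPt, Function.IsFixedPt, Equiv.Perm.iterate_eq_pow]

theorem minimalPeriod_wreathPerm_pos (w : SymWreath H X) (x : X) :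
    0 < Function.minimalPeriod (wreathPerm w) x := by
  rw [Function.minimalPeriod_pos_iff_mem_periodicPts]
  have hmaps : Set.MapsTo (fun n : ℕ => (wreathPerm w ^ n) x) Set.univ
      ({x} ∪ {y | wreathPerm w y ≠ y}) := by
    intro n _
    by_cases hx : wreathPerm w x = x
    · left
      exact Function.IsFixedPt.perm_pow hx n
    · right
      simp only [Set.mem_ofPred_eq]
      rw [← Equiv.Perm.mul_apply, ← pow_succ', pow_succ, Equiv.Perm.mul_apply]
      exact fun h => hx ((wreathPerm w ^ n).injective h)
  obtain ⟨m, -, n, -, hmn, h⟩ := Set.infinite_univ.exists_lt_map_eq_of_mapsTo hmaps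
    ((Set.finite_singleton x).union (finite_wreathPerm_ne w))
  refine ⟨n - m, by omega, isPeriodicPt_perm_iff.2 ?_⟩
  apply (wreathPerm w ^ m).injective
  rw [← Equiv.Perm.mul_apply, ← pow_add, Nat.add_sub_cancel' hmn.le]
  exact h.symm

theorem wreathPerm_pow_minimalPeriod (w : SymWreath H X) (x : X) :
    (wreathPerm w ^ Function.minimalPeriod (wreathPerm w) x) x = x :=
  isPeriodicPt_perm_iff.1 (Function.isPeriodicPt_minimalPeriod _ x)

theorem finite_sameCycle (w : SymWreath H X) (x : X) :
    {y | (wreathPerm w).SameCycle x y}.Finite := by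
  refine ((Set.finite_singleton x).union (finite_wreathPerm_ne w)).subset ?_
  rintro y hy
  by_cases h : wreathPerm w y = y
  · left
    exact hy.symm.eq_of_left h
  · exact Or.inr h

theorem ncard_sameCycle (w : SymWreath H X) (x : X) :
    {y | (wreathPerm w).SameCycle x y}.ncard = Function.minimalPeriod (wreathPerm w) x := by
  have he : {y | (wreathPerm w).SameCycle x y} =
      MulAction.orbit (Subgroup.zpowers (wreathPerm w)) x := by
    ext y
    simp [Equiv.Perm.SameCycle, MulAction.mem_orbit_iff, Subgroup.smul_def]
  have hf := finite_sameCycle w x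
  rw [he] at hf ⊢
  have := hf.fintype
  have h := MulAction.minimalPeriod_eq_card (wreathPerm w) x
  rw [← Nat.card_coe_set_eq, Nat.card_eq_fintype_card, ← h]
  rfl

/-- The label of the cycle of `w` through `x`: the conjugacy class of the cycle product, and the
length of the cycle. -/
noncomputable def cycleLabel (w : SymWreath H X) (x : X) : ConjClasses H × ℕ :=
  (ConjClasses.mk (wreathTwist (w ^ Function.minimalPeriod (wreathPerm w) x) x),
    Function.minimalPeriod (wreathPerm w) x)

/-- Conjugation by `g` carries the cycle through `x` to the one through `g x`, and conjugates its
product by the factor of `g` at `x`. -/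
theorem cycleLabel_conj (g w : SymWreath H X) (x : X) :
    cycleLabel (g * w * g⁻¹) (wreathPerm g x) = cycleLabel w x := by
  have hp : Function.minimalPeriod (wreathPerm (g * w * g⁻¹)) (wreathPerm g x) =
      Function.minimalPeriod (wreathPerm w) x := by
    rw [Function.minimalPeriod_eq_minimalPeriod_iff]
    intro n
    rw [isPeriodicPt_perm_iff, isPeriodicPt_perm_iff, ← map_pow, conj_pow]
    simp
  unfold cycleLabel
  rw [hp]
  refine Prod.ext ?_ rfl
  simp only [ConjClasses.mk_eq_mk_iff_isConj]
  rw [conj_pow, wreathTwist_mul, wreathTwist_inv, wreathTwist_mul, map_inv,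
    show (wreathPerm g)⁻¹ (wreathPerm g x) = x from (wreathPerm g).symm_apply_apply x, map_pow,
    wreathPerm_pow_minimalPeriod]
  exact (isConj_iff.2 ⟨_, rfl⟩).symm

/-- Conjugation by a power of `w` fixes `w` and moves the base point along its cycle. -/
theorem cycleLabel_eq_of_sameCycle {w : SymWreath H X} {x y : X}
    (h : (wreathPerm w).SameCycle x y) : cycleLabel w x = cycleLabel w y := by
  obtain ⟨n, rfl⟩ := h
  have := cycleLabel_conj (w ^ n) w x
  rw [((Commute.refl w).zpow_left n).eq, mul_inv_cancel_right, map_zpow] at this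
  exact this.symm

theorem cycleLabel_eq_one_iff {w : SymWreath H X} {x : X} :
    cycleLabel w x = (1, 1) ↔ wreathPerm w x = x ∧ wreathTwist w x = 1 := by
  unfold cycleLabel
  rw [Prod.mk.injEq, and_comm, Function.minimalPeriod_eq_one_iff_isFixedPt]
  refine and_congr_right fun h => ?_
  rw [Function.minimalPeriod_eq_one_iff_isFixedPt.2 h, pow_one, ConjClasses.one_eq_mk_one,
    ConjClasses.mk_eq_mk_iff_isConj, isConj_comm, isConj_one_right]

theorem finite_cycleLabel_ne (w : SymWreath H X) : {x | cycleLabel w x ≠ (1, 1)}.Finite := by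
  refine ((finite_wreathPerm_ne w).union (finite_wreathTwist_ne w)).subset fun x hx => ?_
  rw [Set.mem_ofPred_eq, Ne, cycleLabel_eq_one_iff, not_and_or] at hx
  exact hx

/-- The set of cycles of an element of `H ≀_X Sym(X)`. -/
abbrev WreathCycle (w : SymWreath H X) : Type _ :=
  Quotient (Equiv.Perm.SameCycle.setoid (wreathPerm w))

/-- The label of a cycle. -/
noncomputable def WreathCycle.label {w : SymWreath H X} : WreathCycle w → ConjClasses H × ℕ :=
  Quotient.lift (cycleLabel w) fun _ _ h => cycleLabel_eq_of_sameCycle h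

theorem WreathCycle.label_mk (w : SymWreath H X) (x : X) :
    WreathCycle.label (Quotient.mk _ x : WreathCycle w) = cycleLabel w x := rfl

theorem finite_label_eq (w : SymWreath H X) {v : ConjClasses H × ℕ} (hv : v ≠ (1, 1)) :
    {o : WreathCycle w | o.label = v}.Finite := by
  refine ((finite_cycleLabel_ne w).image (Quotient.mk _)).subset ?_
  rintro ⟨x⟩ hx
  refine ⟨x, ?_, rfl⟩
  have hx' : cycleLabel w x = v := hx
  simpa [hx'] using hv

open Classical in
/-- The length of the cycles with index `(c, k)`: those with cycle product in `c` which take `k + 1`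
generators to write. -/
noncomputable def cycleSize (v : ConjClasses H × ℕ) : ℕ := v.2 + 1 + if v.1 = 1 then 1 else 0

theorem cycleSize_label_ne (v : ConjClasses H × ℕ) : (v.1, cycleSize v) ≠ (1, 1) := by
  intro h
  simp only [Prod.mk.injEq] at h
  simp [cycleSize, h.1] at h

theorem cycleSize_label_injective :
    Function.Injective fun v : ConjClasses H × ℕ => (v.1, cycleSize v) := by
  intro v v' h
  simp only [Prod.mk.injEq] at h
  refine Prod.ext h.1 ?_
  have := h.2
  unfold cycleSize at this
  rw [h.1] at this
  omega

theorem exists_cycleSize_label_eq {v : ConjClasses H × ℕ} (hv : v ≠ (1, 1)) (h0 : 0 < v.2) :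
    ∃ v' : ConjClasses H × ℕ, (v'.1, cycleSize v') = v := by
  obtain ⟨c, n⟩ := v
  by_cases hc : c = 1
  · subst hc
    have : n ≠ 1 := fun h => hv (by rw [h])
    -- With trivial product, length `n ≥ 2` costs `n - 1 = k + 1` generators, so `k = n - 2`; with
    -- nontrivial product the cost is `n`, so `k = n - 1`.
    refine ⟨(1, n - 2), ?_⟩
    simp only [cycleSize, if_true, Prod.mk.injEq, true_and]
    simp only at h0
    omega
  · refine ⟨(c, n - 1), ?_⟩
    simp only [cycleSize, if_neg hc, Prod.mk.injEq, true_and]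
    simp only at h0
    omega

/-- The number of cycles of `w` of each label other than that of a trivial fixed point. -/
noncomputable def wreathCycleType (w : SymWreath H X) : ConjClasses H × ℕ →₀ ℕ :=
  Finsupp.ofSupportFinite
    (fun v => Nat.card {o : WreathCycle w // o.label = (v.1, cycleSize v)}) <| by
    refine (((finite_cycleLabel_ne w).image (cycleLabel w)).preimage
      cycleSize_label_injective.injOn).subset fun v hv => ?_
    obtain ⟨⟨⟨x⟩, hx⟩⟩ := (Nat.card_ne_zero.1 hv).1
    have hx' : cycleLabel w x = _ := hx
    exact ⟨x, by simpa [hx'] using cycleSize_label_ne v, hx⟩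

theorem wreathCycleType_apply (w : SymWreath H X) (v : ConjClasses H × ℕ) :
    wreathCycleType w v = Nat.card {o : WreathCycle w // o.label = (v.1, cycleSize v)} := rfl

theorem wreathCycleType_conj (g w : SymWreath H X) :
    wreathCycleType (g * w * g⁻¹) = wreathCycleType w := by
  ext v
  rw [wreathCycleType_apply, wreathCycleType_apply]
  refine (Nat.card_congr (Equiv.subtypeEquiv (Quotient.congr (wreathPerm g) ?_) ?_)).symm
  · intro x y
    change (wreathPerm w).SameCycle x y ↔ (wreathPerm (g * w * g⁻¹)).SameCycle _ _
    rw [map_mul, map_mul, map_inv, Equiv.Perm.sameCycle_conj]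
    simp
  · rintro ⟨x⟩
    change cycleLabel w x = _ ↔ cycleLabel (g * w * g⁻¹) (wreathPerm g x) = _
    rw [cycleLabel_conj]

theorem wreathCycleType_eq_of_isConj {w w' : SymWreath H X} (h : IsConj w w') :
    wreathCycleType w = wreathCycleType w' := by
  obtain ⟨g, rfl⟩ := isConj_iff.1 h
  exact (wreathCycleType_conj g w).symm

end WreathBasic

/-! ### The lower bound for word length. -/

section LowerBound

variable {H X : Type*} [Group H]

/-- The index of a cycle type: the sum over the cycles of the number of generators they take. -/
def cycleTypeWeight {C : Type*} (τ : C × ℕ →₀ ℕ) : ℕ := τ.sum fun i m => m * (i.2 + 1)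

/-- The effect on the root labelling of one new edge or half-edge: two labels are identified, `none`
(a component with a half-edge) being absorbing, and at most one vertex stops being a root. -/
theorem exists_option_merge (p q : Option X) : ∃ m : Option X → Option X,
    m none = none ∧ m p = m q ∧ {x | m (some x) ≠ some x}.encard ≤ 1 := by
  classical
  have key : ∀ (r : X) (q : Option X), ∃ m : Option X → Option X,
      m none = none ∧ m (some r) = m q ∧ {x | m (some x) ≠ some x}.encard ≤ 1 := by
    intro r q
    refine ⟨Function.update id (some r) q, by simp, ?_, ?_⟩
    · by_cases h : q = some r
      · rw [h]
      · rw [Function.update_self, Function.update_of_ne h, id]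
    · rw [← Set.encard_singleton r]
      refine Set.encard_le_encard fun x hx => ?_
      by_contra hxr
      simp only [Set.mem_singleton_iff] at hxr
      exact hx (by rw [Function.update_of_ne (by simpa using hxr), id])
  rcases p with _ | r
  · rcases q with _ | r
    · exact ⟨id, rfl, rfl, by simp⟩
    · obtain ⟨m, h1, h2, h3⟩ := key r none
      exact ⟨m, h1, h2.symm, h3⟩
  · exact key r q

/-- A word of length `n` in single elements and transpositions has a graph on `X` with `n` edges and
half-edges. The map `ρ` assigns to each vertex the root of its component if this component has no
half-edge. -/
theorem exists_root_map_of_word (l : List (SymWreath H X))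
    (hl : ∀ s ∈ l, s ∈ wreathSingles H X ∨ s ∈ wreathSwaps H X) :
    ∃ ρ : X → Option X, (∀ x, ρ (wreathPerm l.prod x) = ρ x) ∧
      (∀ x, ρ x ≠ none → wreathTwist l.prod x = 1) ∧
      {x | ρ x ≠ some x}.encard ≤ l.length := by
  classical
  induction l with
  | nil => exact ⟨some, by simp, by simp, by simp⟩
  | cons s t ih =>
    obtain ⟨ρ, h1, h2, h3⟩ := ih fun s hs => hl s (List.mem_cons_of_mem _ hs)
    -- An element supported at `u` merges the label of `u` with `none`; a transposition merges the
    -- labels of its two points.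
    suffices h : ∃ p q : Option X, ∀ m : Option X → Option X, m none = none → m p = m q →
        (∀ x, m (ρ (wreathPerm s x)) = m (ρ x)) ∧
        ∀ x, m (ρ x) ≠ none → wreathTwist s x = 1 by
      obtain ⟨p, q, hpq⟩ := h
      obtain ⟨m, m1, m2, m3⟩ := exists_option_merge p q
      obtain ⟨k1, k2⟩ := hpq m m1 m2
      refine ⟨fun x => m (ρ x), fun x => ?_, fun x hx => ?_, ?_⟩
      · simp only [List.prod_cons, map_mul, Equiv.Perm.mul_apply, k1, h1]
      · rw [List.prod_cons, wreathTwist_mul, k2, h2, one_mul]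
        · intro h
          exact hx (by simp only [h, m1])
        · rwa [h1]
      · have hsub : {x | m (ρ x) ≠ some x} ⊆ {x | ρ x ≠ some x} ∪ {x | m (some x) ≠ some x} := by
          intro x hx
          by_cases h : ρ x = some x
          · right
            simpa [h] using hx
          · exact Or.inl h
        refine (Set.encard_le_encard hsub).trans ((Set.encard_union_le _ _).trans ?_)
        rw [List.length_cons, Nat.cast_add, Nat.cast_one]
        exact add_le_add h3 m3
    rcases hl s List.mem_cons_self with ⟨u, a, -, rfl⟩ | ⟨a, b, -, rfl⟩
    · refine ⟨ρ u, none, fun m m1 m2 => ⟨fun x => rfl, fun x hx => ?_⟩⟩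
      rw [wreathTwist_single, if_neg]
      rintro rfl
      exact hx (by rw [m2, m1])
    · refine ⟨ρ a, ρ b, fun m m1 m2 => ⟨fun x => ?_, fun x hx => rfl⟩⟩
      rw [wreathPerm_swap, Equiv.swap_apply_def]
      split_ifs with ha hb
      · rw [ha, m2]
      · rw [hb, m2]
      · rfl

theorem eq_of_sameCycle_of_apply_eq {β : Type*} {f : Equiv.Perm X} {ρ : X → β}
    (h1 : ∀ x, ρ (f x) = ρ x) {x y : X} (h : f.SameCycle x y) : ρ x = ρ y := by
  obtain ⟨n, rfl⟩ := h
  induction n using Int.induction_on with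
  | zero => simp
  | succ n ih => rw [add_comm, zpow_add, zpow_one, Equiv.Perm.mul_apply, h1, ih]
  | pred n ih =>
    rw [ih, ← h1 ((f ^ (-(n : ℤ) - 1)) x), ← Equiv.Perm.mul_apply, ← zpow_one_add]
    congr 3
    ring

/-- A cycle lies in one component, so it contains at most one root. If it contains a root, all its
factors are `1`, its product is trivial and its length is `v.2 + 2`, so discarding the root leaves
`v.2 + 1` points. Otherwise every point of the cycle counts. -/
theorem le_card_inter_cycle {w : SymWreath H X} {ρ : X → Option X}
    (h1 : ∀ x, ρ (wreathPerm w x) = ρ x) (h2 : ∀ x, ρ x ≠ none → wreathTwist w x = 1)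
    {v : ConjClasses H × ℕ} {x : X} (hx : cycleLabel w x = (v.1, cycleSize v)) :
    v.2 + 1 ≤ {y | (wreathPerm w).SameCycle x y ∧ ρ y ≠ some y}.ncard := by
  have hO := finite_sameCycle w x
  have hcard : {y | (wreathPerm w).SameCycle x y}.ncard = cycleSize v := by
    rw [ncard_sameCycle]
    exact congrArg Prod.snd hx
  by_cases hne : ∃ z, (wreathPerm w).SameCycle x z ∧ ρ z = some z
  · obtain ⟨z, hz, hρ⟩ := hne
    have hv : v.1 = 1 := by
      rw [cycleLabel_eq_of_sameCycle hz] at hx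
      rw [← congrArg Prod.fst hx]
      change ConjClasses.mk _ = 1
      rw [ConjClasses.one_eq_mk_one, wreathTwist_pow_eq_one]
      intro n
      apply h2
      rw [← eq_of_sameCycle_of_apply_eq h1 (x := z) ⟨n, by simp⟩, hρ]
      simp
    have hsub : {y | (wreathPerm w).SameCycle x y} ⊆
        insert z {y | (wreathPerm w).SameCycle x y ∧ ρ y ≠ some y} := by
      intro y hy
      by_cases hy' : ρ y = some y
      · left
        have := eq_of_sameCycle_of_apply_eq h1 (hz.symm.trans hy)
        rw [hρ, hy'] at this
        exact (Option.some_injective _ this).symm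
      · exact Or.inr ⟨hy, hy'⟩
    have h := (Set.ncard_le_ncard hsub ((hO.subset fun y hy => hy.1).insert z)).trans
      (Set.ncard_insert_le _ _)
    rw [hcard, cycleSize, if_pos hv] at h
    omega
  · have hsub : {y | (wreathPerm w).SameCycle x y} ⊆
        {y | (wreathPerm w).SameCycle x y ∧ ρ y ≠ some y} :=
      fun y hy => ⟨hy, fun h => hne ⟨y, hy, h⟩⟩
    have h := Set.ncard_le_ncard hsub (hO.subset fun y hy => hy.1)
    rw [hcard, cycleSize] at h
    omega

open Finset in
theorem cycleTypeWeight_le_of_root_map {w : SymWreath H X} {ρ : X → Option X}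
    (h1 : ∀ x, ρ (wreathPerm w x) = ρ x) (h2 : ∀ x, ρ x ≠ none → wreathTwist w x = 1) {n : ℕ}
    (h3 : {x | ρ x ≠ some x}.encard ≤ n) : cycleTypeWeight (wreathCycleType w) ≤ n := by
  classical
  have hfin : {x | ρ x ≠ some x}.Finite := Set.finite_of_encard_le_coe h3
  set D := hfin.toFinset with hD
  have hDn : #D ≤ n := by
    rw [hfin.encard_eq_coe_toFinset_card] at h3
    exact_mod_cast h3
  refine le_trans ?_ hDn
  have hv : ∀ v, wreathCycleType w v * (v.2 + 1) ≤
      #{x ∈ D | cycleLabel w x = (v.1, cycleSize v)} := by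
    intro v
    have hf := finite_label_eq w (cycleSize_label_ne v)
    have hc : wreathCycleType w v = #hf.toFinset := by
      rw [wreathCycleType_apply, ← Set.ncard_eq_toFinset_card _ hf]
      rfl
    rw [card_eq_sum_card_fiberwise (f := fun x => (Quotient.mk _ x : WreathCycle w))
      (t := hf.toFinset) (fun x hx => by
        rw [Set.Finite.coe_toFinset]
        exact (mem_filter.1 (mem_coe.1 hx)).2), hc, ← smul_eq_mul]
    refine card_nsmul_le_sum _ _ _ fun o ho => ?_
    rw [Set.Finite.mem_toFinset] at ho
    obtain ⟨x, rfl⟩ := Quotient.exists_rep o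
    have hx : cycleLabel w x = (v.1, cycleSize v) := ho
    refine (le_card_inter_cycle h1 h2 hx).trans ?_
    rw [← Set.ncard_coe_finset]
    refine Set.ncard_le_ncard ?_ (Finset.finite_toSet _)
    rintro y ⟨hy, hy'⟩
    simp only [coe_filter, mem_filter, Set.mem_ofPred_eq, hD, Set.Finite.mem_toFinset]
    exact ⟨⟨hy', by rw [← cycleLabel_eq_of_sameCycle hy, hx]⟩, Quotient.sound hy.symm⟩
  calc cycleTypeWeight (wreathCycleType w)
      ≤ ∑ v ∈ (wreathCycleType w).support, #{x ∈ D | cycleLabel w x = (v.1, cycleSize v)} :=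
        sum_le_sum fun v _ => hv v
    _ = #((wreathCycleType w).support.biUnion
          fun v => {x ∈ D | cycleLabel w x = (v.1, cycleSize v)}) := by
        rw [card_biUnion]
        intro v _ v' _ hne
        rw [Function.onFun, disjoint_left]
        intro x hx hx'
        exact hne (cycleSize_label_injective
          ((mem_filter.1 hx).2.symm.trans (mem_filter.1 hx').2))
    _ ≤ #D := card_le_card (biUnion_subset.2 fun v _ => filter_subset _ _)

theorem wreathSingle_inv (u : X) (a : H) : (wreathSingle u a)⁻¹ = wreathSingle u a⁻¹ := by
  classical
  rw [inv_eq_iff_mul_eq_one]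
  refine wreath_ext (fun x => rfl) fun x => ?_
  rw [wreathTwist_mul, wreathTwist_single, wreathTwist_single, wreathPerm_single,
    Equiv.Perm.one_apply, wreathTwist_one]
  split_ifs <;> simp

theorem wreathSwap_inv (x y : X) : (wreathSwap x y : SymWreath H X)⁻¹ = wreathSwap x y := by
  classical
  rw [inv_eq_iff_mul_eq_one]
  refine wreath_ext (fun z => ?_) fun z => by
    rw [wreathTwist_mul, wreathTwist_swap, wreathTwist_swap, one_mul, wreathTwist_one]
  rw [map_mul, wreathPerm_swap, Equiv.swap_mul_self, map_one]

theorem cycleTypeWeight_le_wordLength {S : Set (SymWreath H X)}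
    (hS : S ⊆ wreathSingles H X ∪ wreathSwaps H X) (w : SymWreath H X) :
    (cycleTypeWeight (wreathCycleType w) : ℕ∞) ≤ wordLength S w := by
  refine le_iInf₂ fun l hl => ?_
  obtain ⟨hl, rfl⟩ := hl
  obtain ⟨ρ, h1, h2, h3⟩ := exists_root_map_of_word l fun s hs => by
    rcases hl s hs with h | h
    · exact hS h
    · rcases hS h with ⟨u, a, ha, he⟩ | ⟨x, y, hxy, he⟩
      · left
        rw [inv_eq_iff_eq_inv, wreathSingle_inv] at he
        exact ⟨u, a⁻¹, inv_ne_one.2 ha, he⟩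
      · right
        rw [inv_eq_iff_eq_inv, wreathSwap_inv] at he
        exact ⟨x, y, hxy, he⟩
  exact_mod_cast cycleTypeWeight_le_of_root_map h1 h2 h3

end LowerBound

/-! ### The cycle type determines the conjugacy class. -/

section Conjugacy

variable {H X : Type*} [Group H]

theorem exists_perm_finite_extend {A : Set X} (hA : A.Finite) {f : X → X} (hf : Set.InjOn f A) :
    ∃ σ : Equiv.Perm X, {x | σ x ≠ x}.Finite ∧ ∀ x ∈ A, σ x = f x := by
  classical
  set Z : Finset X := hA.toFinset ∪ (hA.image f).toFinset with hZ
  obtain ⟨g, hg⟩ := Finset.exists_equiv_extend_of_card_eq (α := Z) (t := Z) (Fintype.card_coe Z)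
    (s := Finset.univ.filter fun z : Z => z.1 ∈ A) (f := fun z => f z.1)
    (by
      intro y hy
      obtain ⟨z, hz, rfl⟩ := Finset.mem_image.1 hy
      simp only [hZ, Finset.mem_union, Set.Finite.mem_toFinset]
      exact Or.inr ⟨z.1, (Finset.mem_filter.1 hz).2, rfl⟩)
    (by
      intro z hz z' hz' h
      exact Subtype.ext (hf (by simpa using hz) (by simpa using hz') h))
  refine ⟨Equiv.Perm.ofSubtype g, Z.finite_toSet.subset fun x hx => ?_, fun x hx => ?_⟩
  · by_contra h
    exact hx (Equiv.Perm.ofSubtype_apply_of_not_mem g h)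
  · have hxZ : x ∈ Z := by simp [hZ, hx]
    rw [Equiv.Perm.ofSubtype_apply_of_mem g hxZ]
    exact hg ⟨x, hxZ⟩ (by simpa using hx)

theorem exists_eq_add_mul_of_zpow_apply_eq {f : Equiv.Perm X} {x : X} {i j : ℤ}
    (h : (f ^ i) x = (f ^ j) x) : ∃ m : ℤ, i = j + Function.minimalPeriod f x * m := by
  have h1 : f ^ (i - j) • x = x := by
    rw [Equiv.Perm.smul_def, sub_eq_neg_add, zpow_add, Equiv.Perm.mul_apply, h,
      ← Equiv.Perm.mul_apply, ← zpow_add]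
    simp
  obtain ⟨m, hm⟩ := MulAction.zpow_smul_eq_iff_minimalPeriod_dvd.1 h1
  refine ⟨m, ?_⟩
  have : (Function.minimalPeriod (fun y => f • y) x : ℤ) = Function.minimalPeriod f x := rfl
  rw [← this]
  omega

theorem wreathTwist_zpow_of_fixed {v : SymWreath H X} {x : X} (h : wreathPerm v x = x) (m : ℤ) :
    wreathTwist (v ^ m) x = wreathTwist v x ^ m := by
  have hn : ∀ n : ℕ, wreathTwist (v ^ n) x = wreathTwist v x ^ n := by
    intro n
    induction n with
    | zero => simp
    | succ n ih => rw [pow_succ, wreathTwist_mul, h, ih, pow_succ]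
  rcases m with n | n
  · simpa using hn n
  · have h2 : wreathPerm (v ^ (n + 1)) x = x := by
      rw [map_pow]
      exact Function.IsFixedPt.perm_pow h _
    rw [zpow_negSucc, zpow_negSucc, ← hn]
    nth_rw 1 [← h2]
    rw [wreathTwist_inv]

theorem wreathPerm_zpow_add_mul (w : SymWreath H X) (x : X) (i m : ℤ) :
    (wreathPerm w ^ (i + Function.minimalPeriod (wreathPerm w) x * m)) x =
      (wreathPerm w ^ i) x := by
  rw [zpow_add, Equiv.Perm.mul_apply, zpow_mul, zpow_natCast,
    Function.IsFixedPt.perm_zpow (wreathPerm_pow_minimalPeriod w x)]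

/-- Each full turn around the cycle contributes one factor of the cycle product. -/
theorem wreathTwist_zpow_add_mul (w : SymWreath H X) (x : X) (i m : ℤ) :
    wreathTwist (w ^ (i + Function.minimalPeriod (wreathPerm w) x * m)) x =
      wreathTwist (w ^ i) x *
        wreathTwist (w ^ Function.minimalPeriod (wreathPerm w) x) x ^ m := by
  have h : wreathPerm (w ^ Function.minimalPeriod (wreathPerm w) x) x = x := by
    rw [map_pow, wreathPerm_pow_minimalPeriod]
  rw [zpow_add, zpow_mul, zpow_natCast, wreathTwist_mul, wreathTwist_zpow_of_fixed h, map_zpow,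
    Function.IsFixedPt.perm_zpow h]

/-- The base points `b o` meet each nontrivial cycle of `w` exactly once. -/
structure IsCycleTransversal {N : Type*} (w : SymWreath H X) (b : N → X) : Prop where
  label_ne : ∀ o, cycleLabel w (b o) ≠ (1, 1)
  eq_of_sameCycle : ∀ o o', (wreathPerm w).SameCycle (b o) (b o') → o = o'
  exists_zpow : ∀ x, cycleLabel w x ≠ (1, 1) → ∃ o, ∃ i : ℤ, (wreathPerm w ^ i) (b o) = x

/-- The graph of the partial map intertwining `w` and `w'` which sends `(b o, 1)` to
`(b' o, t o)`. -/
def IntertwiningRel {N : Type*} (w w' : SymWreath H X) (b b' : N → X) (t : N → H)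
    (x y : X) (h : H) : Prop :=
  ∃ (o : N) (i : ℤ), (wreathPerm w ^ i) (b o) = x ∧ (wreathPerm w' ^ i) (b' o) = y ∧
    wreathTwist (w' ^ i) (b' o) * t o * (wreathTwist (w ^ i) (b o))⁻¹ = h

theorem sameCycle_of_zpow_apply_eq {f : Equiv.Perm X} {x y : X} {i j : ℤ}
    (h : (f ^ i) x = (f ^ j) y) : f.SameCycle x y := by
  rw [← Equiv.Perm.sameCycle_zpow_left (n := i), ← Equiv.Perm.sameCycle_zpow_right (n := j), h]

variable {N : Type*} {w w' : SymWreath H X} {b b' : N → X} {t : N → H}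

/-- Two exponents reaching the same point differ by full turns, and by `ht` the powers of the two
cycle products cancel through `t o`. -/
theorem IntertwiningRel.right_unique (hb : IsCycleTransversal w b)
    (hl : ∀ o, cycleLabel w' (b' o) = cycleLabel w (b o))
    (ht : ∀ o, wreathTwist (w' ^ Function.minimalPeriod (wreathPerm w) (b o)) (b' o) =
      t o * wreathTwist (w ^ Function.minimalPeriod (wreathPerm w) (b o)) (b o) * (t o)⁻¹)
    {x y z : X} {g h : H} (h1 : IntertwiningRel w w' b b' t x y g)
    (h2 : IntertwiningRel w w' b b' t x z h) : y = z ∧ g = h := by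
  obtain ⟨o, i, rfl, rfl, rfl⟩ := h1
  obtain ⟨o', j, hx, rfl, rfl⟩ := h2
  obtain rfl := hb.eq_of_sameCycle _ _ (sameCycle_of_zpow_apply_eq hx.symm)
  obtain ⟨m, rfl⟩ := exists_eq_add_mul_of_zpow_apply_eq hx.symm
  have hp : Function.minimalPeriod (wreathPerm w) (b o) =
      Function.minimalPeriod (wreathPerm w') (b' o) := (congrArg Prod.snd (hl o)).symm
  refine ⟨by rw [hp, wreathPerm_zpow_add_mul], ?_⟩
  rw [wreathTwist_zpow_add_mul, hp, wreathTwist_zpow_add_mul, ← hp, ht, conj_zpow]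
  group

theorem IntertwiningRel.left_unique (hb' : IsCycleTransversal w' b')
    (hl : ∀ o, cycleLabel w' (b' o) = cycleLabel w (b o))
    {x y z : X} {g h : H} (h1 : IntertwiningRel w w' b b' t x z g)
    (h2 : IntertwiningRel w w' b b' t y z h) : x = y := by
  obtain ⟨o, i, rfl, rfl, rfl⟩ := h1
  obtain ⟨o', j, rfl, hx, rfl⟩ := h2
  obtain rfl := hb'.eq_of_sameCycle _ _ (sameCycle_of_zpow_apply_eq hx.symm)
  obtain ⟨m, rfl⟩ := exists_eq_add_mul_of_zpow_apply_eq hx.symm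
  have hp : Function.minimalPeriod (wreathPerm w') (b' o) =
      Function.minimalPeriod (wreathPerm w) (b o) := congrArg Prod.snd (hl o)
  rw [hp, wreathPerm_zpow_add_mul]

theorem IntertwiningRel.apply {x y : X} {h : H} (hr : IntertwiningRel w w' b b' t x y h) :
    IntertwiningRel w w' b b' t (wreathPerm w x) (wreathPerm w' y)
      (wreathTwist w' y * h * (wreathTwist w x)⁻¹) := by
  obtain ⟨o, i, rfl, rfl, rfl⟩ := hr
  refine ⟨o, 1 + i, ?_, ?_, ?_⟩
  · rw [zpow_add, zpow_one, Equiv.Perm.mul_apply]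
  · rw [zpow_add, zpow_one, Equiv.Perm.mul_apply]
  · rw [zpow_add, zpow_one, zpow_add, zpow_one, wreathTwist_mul, wreathTwist_mul, map_zpow,
      map_zpow]
    group

/-- The intertwining relation is a partial bijection between the nontrivial points of `w` and `w'`.
The former being finite in number, it extends to a finitary permutation, with fibre factor `1`
elsewhere, which conjugates `w` to `w'`. -/
theorem isConj_of_transversals (hb : IsCycleTransversal w b) (hb' : IsCycleTransversal w' b')
    (hl : ∀ o, cycleLabel w' (b' o) = cycleLabel w (b o)) : IsConj w w' := by
  classical
  have ht : ∀ o, ∃ t : H, wreathTwist (w' ^ Function.minimalPeriod (wreathPerm w) (b o)) (b' o) =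
      t * wreathTwist (w ^ Function.minimalPeriod (wreathPerm w) (b o)) (b o) * t⁻¹ := by
    intro o
    have h1 := congrArg Prod.fst (hl o).symm
    have h2 : Function.minimalPeriod (wreathPerm w') (b' o) =
      Function.minimalPeriod (wreathPerm w) (b o) := congrArg Prod.snd (hl o)
    simp only [cycleLabel, h2, ConjClasses.mk_eq_mk_iff_isConj] at h1
    obtain ⟨t, ht⟩ := isConj_iff.1 h1
    exact ⟨t, ht.symm⟩
  choose t ht using ht
  have hex : ∀ x, ∃ y h, cycleLabel w x ≠ (1, 1) → IntertwiningRel w w' b b' t x y h := by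
    intro x
    by_cases hx : cycleLabel w x = (1, 1)
    · exact ⟨x, 1, fun h => absurd hx h⟩
    · obtain ⟨o, i, hi⟩ := hb.exists_zpow x hx
      exact ⟨_, _, fun _ => ⟨o, i, hi, rfl, rfl⟩⟩
  choose s θ hR using hex
  have hfin := finite_cycleLabel_ne w
  obtain ⟨σ, hσ, hσs⟩ := exists_perm_finite_extend hfin (f := s) fun x hx y hy hxy =>
    (hR x hx).left_unique hb' hl (hxy ▸ hR y hy)
  obtain ⟨g, hg, hgt⟩ := exists_wreath_eq σ hσ
    (fun x => if cycleLabel w x = (1, 1) then 1 else θ x)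
    (hfin.subset fun x hx h => hx (if_pos h))
  have hAf : ∀ x, cycleLabel w (wreathPerm w x) = cycleLabel w x := fun x =>
    (cycleLabel_eq_of_sameCycle ⟨1, by simp⟩).symm
  -- A nontrivial point of `w'` is already the image of a nontrivial point of `w`, so injectivity of
  -- `σ` excludes any other preimage.
  have hoff : ∀ x, cycleLabel w x = (1, 1) → cycleLabel w' (σ x) = (1, 1) := by
    intro x hx
    by_contra h
    obtain ⟨o, i, hi⟩ := hb'.exists_zpow _ h
    have hne : cycleLabel w ((wreathPerm w ^ i) (b o)) ≠ (1, 1) := by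
      rw [← cycleLabel_eq_of_sameCycle (x := b o) ⟨i, rfl⟩]
      exact hb.label_ne o
    have h1 := (hR _ hne).right_unique hb hl ht ⟨o, i, rfl, hi, rfl⟩
    rw [← hσs _ hne] at h1
    rw [σ.injective h1.1] at hne
    exact hne hx
  refine isConj_iff.2 ⟨g, ?_⟩
  rw [mul_inv_eq_iff_eq_mul]
  refine wreath_ext (fun x => ?_) fun x => ?_
  · rw [map_mul, map_mul, Equiv.Perm.mul_apply, Equiv.Perm.mul_apply, hg]
    by_cases hx : cycleLabel w x = (1, 1)
    · rw [(cycleLabel_eq_one_iff.1 hx).1, (cycleLabel_eq_one_iff.1 (hoff x hx)).1]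
    · have hfx : cycleLabel w (wreathPerm w x) ≠ (1, 1) := by rwa [hAf]
      rw [hσs _ hx, hσs _ hfx]
      exact ((hR _ hfx).right_unique hb hl ht (hR _ hx).apply).1
  · rw [wreathTwist_mul, wreathTwist_mul, hgt, hgt, hg, hAf]
    by_cases hx : cycleLabel w x = (1, 1)
    · rw [(cycleLabel_eq_one_iff.1 hx).2, (cycleLabel_eq_one_iff.1 (hoff x hx)).2,
        if_pos hx, if_pos hx]
    · have hfx : cycleLabel w (wreathPerm w x) ≠ (1, 1) := by rwa [hAf]
      rw [if_neg hx, if_neg hx, hσs _ hx,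
        ((hR _ hfx).right_unique hb hl ht (hR _ hx).apply).2, inv_mul_cancel_right]

theorem isCycleTransversal_out {N : Type*} (w : SymWreath H X)
    (e : N ≃ {o : WreathCycle w // o.label ≠ (1, 1)}) :
    IsCycleTransversal w fun o => (e o).1.out where
  label_ne o := by
    rw [← WreathCycle.label_mk, Quotient.out_eq]
    exact (e o).2
  eq_of_sameCycle o o' h := by
    refine e.injective (Subtype.ext ?_)
    rw [← Quotient.out_eq (e o).1, ← Quotient.out_eq (e o').1]
    exact Quotient.sound h
  exists_zpow x hx := by
    refine ⟨e.symm ⟨Quotient.mk _ x, hx⟩, ?_⟩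
    rw [Equiv.apply_symm_apply]
    exact Quotient.mk_out (s := Equiv.Perm.SameCycle.setoid (wreathPerm w)) x

theorem exists_cycle_equiv (h : wreathCycleType w = wreathCycleType w') :
    ∃ e : {o : WreathCycle w // o.label ≠ (1, 1)} ≃ {o : WreathCycle w' // o.label ≠ (1, 1)},
      ∀ o, (e o).1.label = o.1.label := by
  have key : ∀ c : ConjClasses H × ℕ,
      Nonempty ({o : {o : WreathCycle w // o.label ≠ (1, 1)} // o.1.label = c} ≃
        {o : {o : WreathCycle w' // o.label ≠ (1, 1)} // o.1.label = c}) := by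
    intro c
    by_cases hc : c = (1, 1)
    · have h1 : IsEmpty {o : {o : WreathCycle w // o.label ≠ (1, 1)} // o.1.label = c} :=
        ⟨fun o => o.1.2 (o.2.trans hc)⟩
      have h2 : IsEmpty {o : {o : WreathCycle w' // o.label ≠ (1, 1)} // o.1.label = c} :=
        ⟨fun o => o.1.2 (o.2.trans hc)⟩
      exact ⟨Equiv.equivOfIsEmpty _ _⟩
    have hsub : ∀ v : SymWreath H X,
        Nonempty ({o : {o : WreathCycle v // o.label ≠ (1, 1)} // o.1.label = c} ≃
          {o : WreathCycle v // o.label = c}) := fun v =>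
      ⟨Equiv.subtypeSubtypeEquivSubtype (p := fun o : WreathCycle v => o.label ≠ (1, 1))
        (q := fun o => o.label = c) fun {o} ho => by rw [ho]; exact hc⟩
    suffices Nonempty ({o : WreathCycle w // o.label = c} ≃ {o : WreathCycle w' // o.label = c}) by
      obtain ⟨e⟩ := this
      obtain ⟨e1⟩ := hsub w
      obtain ⟨e2⟩ := hsub w'
      exact ⟨(e1.trans e).trans e2.symm⟩
    -- Length `0` does not occur; every other nontrivial label is counted by the cycle type.
    rcases Nat.eq_zero_or_pos c.2 with h0 | h0
    · have hempty : ∀ v : SymWreath H X, IsEmpty {o : WreathCycle v // o.label = c} := by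
        refine fun v => ⟨?_⟩
        rintro ⟨⟨x⟩, hx⟩
        have h1 : cycleLabel v x = c := hx
        have h2 := minimalPeriod_wreathPerm_pos v x
        rw [← h1] at h0
        exact h2.ne' h0
      have := hempty w
      have := hempty w'
      exact ⟨Equiv.equivOfIsEmpty _ _⟩
    · obtain ⟨v, rfl⟩ := exists_cycleSize_label_eq hc h0
      have : Finite {o : WreathCycle w // o.label = (v.1, cycleSize v)} := finite_label_eq w hc
      have : Finite {o : WreathCycle w' // o.label = (v.1, cycleSize v)} := finite_label_eq w' hc
      exact Finite.card_eq.1 (DFunLike.congr_fun h v)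
  exact ⟨Equiv.ofFiberEquiv fun c => (key c).some,
    Equiv.ofFiberEquiv_map (f := fun o : {o : WreathCycle w // o.label ≠ (1, 1)} => o.1.label)
      (g := fun o : {o : WreathCycle w' // o.label ≠ (1, 1)} => o.1.label)
      fun c => (key c).some⟩

theorem isConj_of_wreathCycleType_eq (h : wreathCycleType w = wreathCycleType w') :
    IsConj w w' := by
  obtain ⟨e, he⟩ := exists_cycle_equiv h
  refine isConj_of_transversals (isCycleTransversal_out w (Equiv.refl _))
    (isCycleTransversal_out w' e) fun o => ?_
  rw [← WreathCycle.label_mk, ← WreathCycle.label_mk, Quotient.out_eq, Quotient.out_eq, he]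
  rfl

end Conjugacy

/-! ### Upper bounds for word length. -/

section Words

variable {G : Type*} [Group G] {S : Set G}

/-- `g` is a product of at most `n` elements of `S ∪ S⁻¹`. -/
def HasWord (S : Set G) (n : ℕ) (g : G) : Prop :=
  ∃ l : List G, (∀ s ∈ l, s ∈ S ∨ s⁻¹ ∈ S) ∧ l.prod = g ∧ l.length ≤ n

theorem HasWord.wordLength_le {n : ℕ} {g : G} (h : HasWord S n g) : wordLength S g ≤ n := by
  obtain ⟨l, hl, hg, hn⟩ := h
  exact (iInf₂_le l ⟨hl, hg⟩).trans (by exact_mod_cast hn)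

theorem hasWord_one (n : ℕ) : HasWord S n 1 := ⟨[], by simp⟩

theorem hasWord_of_mem {g : G} (hg : g ∈ S) : HasWord S 1 g := ⟨[g], by simp [hg]⟩

theorem HasWord.mul {m n : ℕ} {g h : G} (hg : HasWord S m g) (hh : HasWord S n h) :
    HasWord S (m + n) (g * h) := by
  obtain ⟨l, hl, rfl, hm⟩ := hg
  obtain ⟨k, hk, rfl, hn⟩ := hh
  refine ⟨l ++ k, fun s hs => ?_, List.prod_append, ?_⟩
  · exact (List.mem_append.1 hs).elim (hl s) (hk s)
  · rw [List.length_append]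
    omega

end Words

/-! ### Minimal representatives of all cycle types, from the forests of a PCwr set. -/

section Realization

variable {H X : Type*} [Group H]

theorem sameCycle_of_forall_sameCycle_apply {f g : Equiv.Perm X} (h : ∀ x, g.SameCycle x (f x))
    {x y : X} (hxy : f.SameCycle x y) : g.SameCycle x y := by
  have := eq_of_sameCycle_of_apply_eq
    (ρ := fun x => (Quotient.mk (Equiv.Perm.SameCycle.setoid g) x)) (f := f)
    (fun x => Quotient.sound (h x).symm) hxy
  exact Quotient.exact this

/-- When `u ≠ v`, the fixed point `v` is inserted after `u`: now `u ↦ v ↦ f u`, whence the exponent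
`2` below. -/
theorem sameCycle_mul_swap [DecidableEq X] {f : Equiv.Perm X} {u v : X} (hv : f v = v) {x y : X}
    (h : f.SameCycle x y) : (f * Equiv.swap u v).SameCycle x y := by
  refine sameCycle_of_forall_sameCycle_apply (fun z => ?_) h
  by_cases hzu : z = u
  · refine ⟨2, ?_⟩
    rw [hzu, zpow_ofNat, pow_two, Equiv.Perm.mul_apply, Equiv.Perm.mul_apply (f) _ u,
      Equiv.swap_apply_left, hv, Equiv.Perm.mul_apply, Equiv.swap_apply_right]
  · by_cases hzv : z = v
    · rw [hzv, hv]
    · refine ⟨1, ?_⟩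
      rw [zpow_one, Equiv.Perm.mul_apply, Equiv.swap_apply_of_ne_of_ne hzu hzv]

/-- A connected set of `m + 1` vertices of the transposition graph contains the support of a product
of `m` transpositions which is transitive on it. -/
theorem exists_hasWord_transitive {SX S : Set (SymWreath H X)} (hSX : SX ⊆ S)
    (T : (transpositionGraph SX).Subgraph) (hT : T.coe.Connected) (hfin : T.verts.Finite) (m : ℕ)
    (hm : m + 1 ≤ T.verts.ncard) :
    ∃ (U : Set X) (w : SymWreath H X), U ⊆ T.verts ∧ U.ncard = m + 1 ∧ HasWord S m w ∧
      (∀ x, wreathTwist w x = 1) ∧ (∀ x, x ∉ U → wreathPerm w x = x) ∧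
      ∀ x ∈ U, ∀ y ∈ U, (wreathPerm w).SameCycle x y := by
  classical
  induction m with
  | zero =>
    obtain ⟨⟨x, hx⟩⟩ := hT.nonempty
    refine ⟨{x}, 1, by simpa using hx, by simp, hasWord_one 0, fun _ => rfl, fun _ _ => rfl, ?_⟩
    rintro x rfl y rfl
    exact Equiv.Perm.SameCycle.refl _ _
  | succ m ih =>
    obtain ⟨U, w, hU, hcard, hw, htw, hoff, htrans⟩ := ih (by omega)
    have hUfin : U.Finite := hfin.subset hU
    obtain ⟨u₀, hu₀⟩ : U.Nonempty := by
      rw [← Set.ncard_pos hUfin]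
      omega
    obtain ⟨v₀, hv₀, hv₀U⟩ : ∃ v ∈ T.verts, v ∉ U := by
      by_contra! h
      have := Set.ncard_le_ncard (t := U) h hUfin
      omega
    obtain ⟨p⟩ := hT.preconnected ⟨u₀, hU hu₀⟩ ⟨v₀, hv₀⟩
    -- A walk leaving `U` crosses an edge from some `u ∈ U` to some `v ∉ U`; that edge is the next
    -- transposition.
    obtain ⟨d, -, hd1, hd2⟩ := p.exists_boundary_dart (Subtype.val ⁻¹' U) hu₀ hv₀U
    set u : X := d.fst.1
    set v : X := d.snd.1
    have hadj : T.Adj u v := d.adj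
    have hu : u ∈ U := hd1
    have hv : v ∉ U := hd2
    have hperm : wreathPerm (w * wreathSwap u v) = wreathPerm w * Equiv.swap u v := by
      rw [map_mul, wreathPerm_swap]
    have huv : (wreathPerm w * Equiv.swap u v).SameCycle u v := by
      refine ⟨1, ?_⟩
      rw [zpow_one, Equiv.Perm.mul_apply, Equiv.swap_apply_left, hoff v hv]
    have hcyc : ∀ x ∈ insert v U, (wreathPerm w * Equiv.swap u v).SameCycle u x := by
      rintro x (rfl | hx)
      · exact huv
      · exact sameCycle_mul_swap (hoff v hv) (htrans u hu x hx)
    refine ⟨insert v U, w * wreathSwap u v, Set.insert_subset (T.edge_vert hadj.symm) hU, ?_,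
      hw.mul (hasWord_of_mem (hSX (T.adj_sub hadj).2)), fun x => ?_, fun x hx => ?_, ?_⟩
    · rw [Set.ncard_insert_of_notMem hv hUfin, hcard]
    · rw [wreathTwist_mul, htw, wreathTwist_swap, one_mul]
    · rw [Set.mem_insert_iff, not_or] at hx
      rw [hperm, Equiv.Perm.mul_apply, Equiv.swap_apply_of_ne_of_ne _ hx.1, hoff x hx.2]
      rintro rfl
      exact hx.2 hu
    · intro x hx y hy
      rw [hperm]
      exact (hcyc x hx).symm.trans (hcyc y hy)

/-- `w` acts trivially on the fibres outside `V`. -/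
def IsSupportedOn (w : SymWreath H X) (V : Set X) : Prop :=
  ∀ x, x ∉ V → wreathPerm w x = x ∧ wreathTwist w x = 1

theorem IsSupportedOn.apply_mem {w : SymWreath H X} {V : Set X} (h : IsSupportedOn w V) {x : X}
    (hx : x ∈ V) : wreathPerm w x ∈ V := by
  by_contra hV
  have := (wreathPerm w).injective (h _ hV).1
  rw [this] at hV
  exact hV hx

-- The transpositions make the tree a single cycle, and one element at `x₀` gives it any desired
-- product; a trivial product needs no such element, which is the case distinction in `cycleSize`.
open Classical in
theorem exists_hasWord_cycle {SX S : Set (SymWreath H X)} (hSX : SX ⊆ S)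
    (T : (transpositionGraph SX).Subgraph) (hT : T.coe.Connected) (v : ConjClasses H × ℕ)
    (hcard : T.verts.ncard = cycleSize v) {x₀ : X} (hx₀ : x₀ ∈ T.verts)
    (hS : ∀ a : H, a ≠ 1 → wreathSingle x₀ a ∈ S) :
    ∃ (w : SymWreath H X) (a : H), ConjClasses.mk a = v.1 ∧ HasWord S (v.2 + 1) w ∧
      IsSupportedOn w T.verts ∧ (∀ x, wreathTwist w x = if x = x₀ then a else 1) ∧
      ∀ x ∈ T.verts, ∀ y ∈ T.verts, (wreathPerm w).SameCycle x y := by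
  have hpos : 0 < T.verts.ncard := by
    rw [hcard, cycleSize]
    omega
  have hfin : T.verts.Finite := Set.finite_of_ncard_pos hpos
  obtain ⟨U, w, hU, hUcard, hw, htw, hoff, htrans⟩ := exists_hasWord_transitive hSX T hT hfin
    (T.verts.ncard - 1) (by omega)
  obtain rfl : U = T.verts := Set.eq_of_subset_of_ncard_le hU (by omega) hfin
  obtain ⟨a, ha⟩ := ConjClasses.exists_rep v.1
  refine ⟨w * wreathSingle x₀ a, a, ha, ?_, fun x hx => ⟨?_, ?_⟩, fun x => ?_, ?_⟩
  · by_cases ha1 : a = 1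
    · have h1 : (wreathSingle x₀ a : SymWreath H X) = 1 := by
        refine wreath_ext (fun x => rfl) fun x => ?_
        rw [wreathTwist_single, ha1, ite_self, wreathTwist_one]
      have hv : v.1 = 1 := by rw [← ha, ha1, ConjClasses.one_eq_mk_one]
      rw [h1, mul_one]
      rwa [hcard, cycleSize, if_pos hv, Nat.add_sub_cancel] at hw
    · have hv : v.1 ≠ 1 := by
        rw [← ha, ConjClasses.one_eq_mk_one, Ne, ConjClasses.mk_eq_mk_iff_isConj, isConj_comm,
          isConj_one_right]
        exact ha1
      rw [hcard, cycleSize, if_neg hv, add_zero, Nat.add_sub_cancel] at hw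
      exact hw.mul (hasWord_of_mem (hS a ha1))
  · rw [map_mul, wreathPerm_single, mul_one, hoff x hx]
  · rw [wreathTwist_mul, htw, wreathTwist_single, if_neg, one_mul]
    rintro rfl
    exact hx hx₀
  · rw [wreathTwist_mul, htw, wreathTwist_single, one_mul]
  · simpa only [map_mul, wreathPerm_single, mul_one] using htrans

theorem exists_hasWord_disjoint_prod {ι : Type*} {S : Set (SymWreath H X)} {V : ι → Set X}
    (hV : ∀ i j, i ≠ j → Disjoint (V i) (V j)) {w : ι → SymWreath H X} {n : ι → ℕ}
    (hw : ∀ i, HasWord S (n i) (w i)) (hs : ∀ i, IsSupportedOn (w i) (V i)) (s : Finset ι) :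
    ∃ g : SymWreath H X, HasWord S (∑ i ∈ s, n i) g ∧ IsSupportedOn g (⋃ i ∈ s, V i) ∧
      ∀ i ∈ s, ∀ x ∈ V i, wreathPerm g x = wreathPerm (w i) x ∧
        wreathTwist g x = wreathTwist (w i) x := by
  classical
  induction s using Finset.induction_on with
  | empty => exact ⟨1, hasWord_one _, fun x _ => ⟨rfl, rfl⟩, by simp⟩
  | insert a s ha ih =>
    obtain ⟨g, hg, hgs, hgi⟩ := ih
    refine ⟨w a * g, by rw [Finset.sum_insert ha]; exact (hw a).mul hg, fun x hx => ?_,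
      fun i hi x hx => ?_⟩
    · rw [Finset.set_biUnion_insert, Set.mem_union, not_or] at hx
      rw [map_mul, Equiv.Perm.mul_apply, wreathTwist_mul, (hgs x hx.2).1, (hgs x hx.2).2,
        (hs a x hx.1).1, (hs a x hx.1).2, one_mul]
      exact ⟨rfl, rfl⟩
    · rw [map_mul, Equiv.Perm.mul_apply, wreathTwist_mul]
      rcases Finset.mem_insert.1 hi with rfl | his
      · have hx' : x ∉ ⋃ j ∈ s, V j := by
          simp only [Set.mem_iUnion, not_exists]
          intro j hj hxj
          refine Set.disjoint_left.1 (hV i j ?_) hx hxj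
          rintro rfl
          exact ha hj
        rw [(hgs x hx').1, (hgs x hx').2, mul_one]
        exact ⟨rfl, rfl⟩
      · have hne : i ≠ a := by
          rintro rfl
          exact ha his
        have hx' : wreathPerm (w i) x ∉ V a :=
          Set.disjoint_left.1 (hV i a hne) ((hs i).apply_mem hx)
        rw [(hgi i his x hx).1, (hgi i his x hx).2, (hs a _ hx').1, (hs a _ hx').2, one_mul]
        exact ⟨rfl, rfl⟩

/-- The only possibly nontrivial factor is met once per turn, since `x₀` does not recur before the
period. -/
theorem cycleLabel_eq_of_twist {g : SymWreath H X} {V : Set X} {x₀ : X} {a : H}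
    (hV : {y | (wreathPerm g).SameCycle x₀ y} = V) (h₀ : wreathTwist g x₀ = a)
    (h1 : ∀ x ∈ V, x ≠ x₀ → wreathTwist g x = 1) :
    cycleLabel g x₀ = (ConjClasses.mk a, V.ncard) := by
  have hp : Function.minimalPeriod (wreathPerm g) x₀ = V.ncard := by rw [← ncard_sameCycle, hV]
  have key : ∀ n : ℕ, n + 1 ≤ Function.minimalPeriod (wreathPerm g) x₀ →
      wreathTwist (g ^ (n + 1)) x₀ = a := by
    intro n hn
    induction n with
    | zero => rw [zero_add, pow_one, h₀]
    | succ n ih =>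
      rw [pow_succ', wreathTwist_mul, ih (by omega), map_pow, h1, one_mul]
      · rw [← hV]
        exact ⟨(n + 1 : ℕ), by rw [zpow_natCast]⟩
      · intro h
        have := (isPeriodicPt_perm_iff.2 h).minimalPeriod_le (Nat.succ_pos n)
        omega
  unfold cycleLabel
  have := minimalPeriod_wreathPerm_pos g x₀
  obtain ⟨n, hn⟩ := Nat.exists_eq_add_of_lt this
  rw [zero_add] at hn
  rw [← hp, hn, key n hn.ge]

theorem card_sigma_support_eq {α : Type*} (τ : α →₀ ℕ) (v : α) :
    Nat.card {i : Σ v : τ.support, Fin (τ v) // i.1.1 = v} = τ v := by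
  by_cases hv : v ∈ τ.support
  · have e : {i : Σ v : τ.support, Fin (τ v) // i.1.1 = v} ≃
        {i : Σ v : τ.support, Fin (τ v) // i.1 = ⟨v, hv⟩} :=
      Equiv.subtypeEquivRight fun i => by rw [Subtype.ext_iff]
    rw [Nat.card_congr (e.trans (Equiv.sigmaSubtype _)), Nat.card_fin]
  · have : IsEmpty {i : Σ v : τ.support, Fin (τ v) // i.1.1 = v} :=
      ⟨fun i => hv (i.2 ▸ i.1.1.2)⟩
    rw [Nat.card_of_isEmpty, Finsupp.notMem_support_iff.1 hv]

/-- `IsPCwr` offers forests only for weakly decreasing sizes, so the cycles have to be sorted. -/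
theorem exists_equiv_fin_antitone {ι : Type*} [Fintype ι] (l : ι → ℕ) :
    ∃ e : ι ≃ Fin (Fintype.card ι), Antitone (l ∘ e.symm) := by
  let e₀ := Fintype.equivFin ι
  let σ := Tuple.sort (OrderDual.toDual ∘ l ∘ e₀.symm)
  refine ⟨e₀.trans σ.symm, ?_⟩
  exact Tuple.monotone_sort (OrderDual.toDual ∘ l ∘ e₀.symm)

/-- One tree of `cycleSize v` vertices is taken for each of the `τ v` cycles of index `v`; the
cycles built on disjoint trees are multiplied together, and their costs add up to the weight of `τ`.
-/
theorem exists_hasWord_wreathCycleType_eq {S : Set (SymWreath H X)} (hS : IsPCwr S)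
    (τ : ConjClasses H × ℕ →₀ ℕ) :
    ∃ w, HasWord S (cycleTypeWeight τ) w ∧ wreathCycleType w = τ := by
  classical
  obtain ⟨SH, -, SX, -, rfl, -, hforest⟩ := hS
  let ι := Σ v : τ.support, Fin (τ v)
  let idx : ι → ConjClasses H × ℕ := fun i => i.1.1
  obtain ⟨e, he⟩ := exists_equiv_fin_antitone fun i : ι => cycleSize (idx i)
  obtain ⟨T, hdisj, hT⟩ := hforest _ _ he fun i => by
    simp only [Function.comp, cycleSize]
    omega
  have hcyc : ∀ i : ι, ∃ x₀ ∈ (T (e i)).verts, ∃ (w : SymWreath H X) (a : H),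
      ConjClasses.mk a = (idx i).1 ∧ HasWord (SH ∪ SX) ((idx i).2 + 1) w ∧
      IsSupportedOn w (T (e i)).verts ∧ (∀ x, wreathTwist w x = if x = x₀ then a else 1) ∧
      ∀ x ∈ (T (e i)).verts, ∀ y ∈ (T (e i)).verts, (wreathPerm w).SameCycle x y := by
    intro i
    obtain ⟨htree, hcard, x₀, hx₀, hSH⟩ := hT (e i)
    refine ⟨x₀, hx₀, exists_hasWord_cycle Set.subset_union_right _ htree.connected _ ?_ hx₀
      fun a ha => Or.inl (hSH a ha)⟩
    rw [hcard, Function.comp, Equiv.symm_apply_apply]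
  choose x₀ hx₀ w a ha hw hsupp htw htrans using hcyc
  have hV : ∀ i j : ι, i ≠ j → Disjoint (T (e i)).verts (T (e j)).verts := fun i j hij =>
    hdisj _ _ (e.injective.ne hij)
  obtain ⟨g, hg, hgs, hgi⟩ := exists_hasWord_disjoint_prod hV hw hsupp Finset.univ
  have hgi' : ∀ i, ∀ x ∈ (T (e i)).verts, wreathPerm g x = wreathPerm (w i) x ∧
      wreathTwist g x = wreathTwist (w i) x := fun i => hgi i (Finset.mem_univ i)
  -- An equality of propositions, so that membership in a tree is an invariant function to which
  -- `eq_of_sameCycle_of_apply_eq` applies.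
  have hmem : ∀ i z, (wreathPerm g z ∈ (T (e i)).verts) = (z ∈ (T (e i)).verts) := by
    intro i z
    refine propext ⟨fun h => ?_, fun h => ?_⟩
    · by_cases hz : ∃ j, z ∈ (T (e j)).verts
      · obtain ⟨j, hj⟩ := hz
        have h' : wreathPerm g z ∈ (T (e j)).verts := by
          rw [(hgi' j z hj).1]
          exact (hsupp j).apply_mem hj
        by_cases hij : i = j
        · rwa [hij]
        · exact absurd h' (Set.disjoint_left.1 (hV i j hij) h)
      · rwa [(hgs z (by simpa using hz)).1] at h
    · rw [(hgi' i z h).1]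
      exact (hsupp i).apply_mem h
  have hcycle : ∀ i, {y | (wreathPerm g).SameCycle (x₀ i) y} = (T (e i)).verts := by
    intro i
    refine Set.Subset.antisymm (fun y hy => ?_) fun y hy => ?_
    · have := eq_of_sameCycle_of_apply_eq (ρ := fun z => z ∈ (T (e i)).verts) (hmem i) hy
      exact this ▸ hx₀ i
    · refine sameCycle_of_forall_sameCycle_apply (fun z => ?_) (htrans i _ (hx₀ i) y hy)
      by_cases hz : z ∈ (T (e i)).verts
      · exact ⟨1, by rw [zpow_one, (hgi' i z hz).1]⟩
      · rw [(hsupp i z hz).1]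
  have hlabel : ∀ i, cycleLabel g (x₀ i) = ((idx i).1, cycleSize (idx i)) := by
    intro i
    rw [cycleLabel_eq_of_twist (a := a i) (hcycle i), ha, (hT (e i)).2.1, Function.comp,
      Equiv.symm_apply_apply]
    · rw [(hgi' i _ (hx₀ i)).2, htw, if_pos rfl]
    · intro x hx hne
      rw [(hgi' i _ hx).2, htw, if_neg hne]
  refine ⟨g, ?_, ?_⟩
  · have hsum : ∑ i : ι, ((idx i).2 + 1) = cycleTypeWeight τ := by
      rw [Fintype.sum_sigma]
      simp only [idx, Finset.sum_const, Finset.card_univ, Fintype.card_fin, smul_eq_mul]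
      exact Finset.sum_coe_sort τ.support fun v => τ v * (v.2 + 1)
    rwa [hsum] at hg
  · ext v
    rw [← card_sigma_support_eq τ v, wreathCycleType_apply]
    -- Trees of index `v` correspond to cycles of `g` with that label: disjointness gives
    -- injectivity, and points outside all trees carry the trivial label.
    refine (Nat.card_congr (Equiv.ofBijective
      (fun i : {i : ι // idx i = v} => (⟨Quotient.mk _ (x₀ i.1), by
        rw [WreathCycle.label_mk, hlabel, i.2]⟩ :
        {o : WreathCycle g // o.label = (v.1, cycleSize v)})) ⟨?_, ?_⟩)).symm
    · intro i j hij
      have h : (wreathPerm g).SameCycle (x₀ i.1) (x₀ j.1) :=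
        Quotient.exact (congrArg Subtype.val hij)
      have h1 : x₀ j.1 ∈ (T (e i.1)).verts := by
        rw [← hcycle]
        exact h
      by_contra hne
      exact Set.disjoint_left.1 (hV i.1 j.1 fun h => hne (Subtype.ext h)) h1 (hx₀ j.1)
    · rintro ⟨⟨x⟩, hx⟩
      have hx' : cycleLabel g x = (v.1, cycleSize v) := hx
      obtain ⟨i, hi⟩ : ∃ i, x ∈ (T (e i)).verts := by
        by_contra h
        refine cycleSize_label_ne v (hx'.symm.trans (cycleLabel_eq_one_iff.2 (hgs x ?_)))
        simpa using h
      have hsame : (wreathPerm g).SameCycle (x₀ i) x := by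
        rw [← hcycle] at hi
        exact hi
      refine ⟨⟨i, ?_⟩, Subtype.ext (Quotient.sound hsame)⟩
      apply cycleSize_label_injective
      simp only
      rw [← hlabel, cycleLabel_eq_of_sameCycle hsame, hx']

end Realization

/-! ### Conjugacy growth as a count of coloured partitions. -/

section ConjugacyGrowthWreath

variable {H X : Type*} [Group H]

/-- The cycle type of a conjugacy class of `H ≀_X Sym(X)`. -/
noncomputable def conjClassCycleType : ConjClasses (SymWreath H X) → (ConjClasses H × ℕ →₀ ℕ) :=
  Quotient.lift wreathCycleType fun _ _ h => wreathCycleType_eq_of_isConj h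

theorem conjClassCycleType_bijective {S : Set (SymWreath H X)} (hS : IsPCwr S) :
    Function.Bijective (conjClassCycleType (H := H) (X := X)) := by
  refine ⟨?_, fun τ => ?_⟩
  · rintro ⟨w⟩ ⟨w'⟩ h
    exact Quotient.sound (isConj_of_wreathCycleType_eq h)
  · obtain ⟨w, -, hw⟩ := exists_hasWord_wreathCycleType_eq hS τ
    exact ⟨ConjClasses.mk w, hw⟩

theorem conjugacyLength_eq_cycleTypeWeight {S : Set (SymWreath H X)} (hS : IsPCwr S)
    (c : ConjClasses (SymWreath H X)) :
    conjugacyLength S c = cycleTypeWeight (conjClassCycleType c) := by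
  refine le_antisymm ?_ (le_iInf₂ fun g hg => ?_)
  · obtain ⟨w, hw, hwc⟩ := exists_hasWord_wreathCycleType_eq hS (conjClassCycleType c)
    have hmem : ConjClasses.mk w = c := (conjClassCycleType_bijective hS).1 hwc
    exact (iInf₂_le w (ConjClasses.mem_carrier_iff_mk_eq.2 hmem)).trans hw.wordLength_le
  · rw [← ConjClasses.mem_carrier_iff_mk_eq.1 hg]
    obtain ⟨SH, hSH, SX, hSX, rfl, -⟩ := hS
    exact cycleTypeWeight_le_wordLength (Set.union_subset_union hSH hSX) g

theorem conjugacyGrowth_eq_encard_colouredPartitions {S : Set (SymWreath H X)} (hS : IsPCwr S)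
    (n : ℕ) : conjugacyGrowth S n = (colouredPartitions (ConjClasses H) n).encard := by
  rw [← Set.encard_preimage_of_bijective (conjClassCycleType_bijective hS), conjugacyGrowth]
  congr 1
  ext c
  rw [Set.mem_ofPred_eq, conjugacyLength_eq_cycleTypeWeight hS, Nat.cast_inj]
  rfl

end ConjugacyGrowthWreath

theorem mainTheorem9 {H X : Type*} [Group H] [Finite H] [Infinite X]
    (S : Set (SymWreath H X)) (hS : IsPCwr S) :
    conjugacyGrowthRate S =
      ((Real.pi * Real.sqrt (2 * (Nat.card (ConjClasses H) : ℝ) / 3) : ℝ) : EReal) := by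
  unfold conjugacyGrowthRate
  simp only [conjugacyGrowth_eq_encard_colouredPartitions hS]
  exact limsup_log_encard_colouredPartitions (ConjClasses H)
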